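/- Let $\mathbb{K}$ be an algebraically closed field, let $N\geqslant 2$ and $c,r\geqslant 0$ be integers with $2c+r\geqslant N$ and $c+r\leqslant N-1$, and put $n:=N-(c+r)$. Let $\lambda_0,\dots,\lambda_N\geqslant 1$ be integers and let $$F_i=\sum_{j=0}^N A_i^j\,z_j^{\lambda_j}\in\mathbb{K}[z_0,\dots,z_N]\qquad(i=1,\dots,c+r),$$ where $A_i^j$ is homogeneous of degree $d_i-\lambda_j\geqslant 0$, so that $F_i$ is homogeneous of degree $\deg F_i=d_i$. Let $V=\{F_1=\dots=F_c=0\}$ and $X=\{F_1=\dots=F_{c+r}=0\}$ in $\mathbb{P}^N_{\mathbb{K}}$, and assume that both are smooth complete intersections, i.e. that $dF_1|_z,\dots,dF_c|_z$ (resp. $dF_1|_z,\dots,dF_{c+r}|_z$) are linearly independent at every $z\neq 0$ with $[z]\in V$ (resp. $[z]\in X$). Let $\pi:\mathbb{K}^{N+1}\setminus\{0\}\to\mathbb{P}^N$ be the projection, $\widehat V=\pi^{-1}(V)$, $\widehat X=\pi^{-1}(X)$, and let $\Omega_{\mathrm{hor}}\widehat V$ be the dual of the bundle on $\widehat V$ with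 fibre $\{[\xi]\in\mathbb{K}^{N+1}/\mathbb{K}z:\ dF_i|_z(\xi)=0,\ i=1,\dots,c\}$ at $z$. Put $\widetilde{\mathsf A}_i^j:=A_i^j z_j$ and $\mathsf B_i^j:=z_j\,dA_i^j+\lambda_jA_i^j\,dz_j$, and let $\mathsf C$ be the $(c+r+c)\times(N+1)$ matrix with rows $(\widetilde{\mathsf A}_i^0,\dots,\widetilde{\mathsf A}_i^N)$ for $i=1,\dots,c+r$, followed by $(\mathsf B_i^0,\dots,\mathsf B_i^N)$ for $i=1,\dots,c$. Let $l_1\geqslant l_2\geqslant 1$ be integers with $l_1+l_2=c+r+n=N$, and let $1\leqslant i_1<\dots<i_{l_1}\leqslant c+r$ and $1\leqslant j_1<\dots<j_{l_2}\leqslant c$ with $\{j_1,\dots,j_{l_2}\}\subset\{i_1,\dots,i_{l_1}\}$. For $j=0,\dots,N$ let $\widehat{\mathsf C}_j$ be the $N\times N$ matrix formed by the rows $i_1,\dots,i_{l_1},c+r+j_1,\dots,c+r+j_{l_2}$ of $\mathsf C$, with the $(j+1)$-th column omitted. Then the symmetric forms $$\widehat\omega_j=\frac{(-1)^j}{z_j^{\lambda_j-1}}\det(\widehat{\mathsf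 C}_j)\quad\text{on }\widehat X\cap\{z_j\neq 0\}\qquad(j=0,\dots,N)$$ are (pull-backs of) horizontal symmetric forms and glue to a unique global regular section $\widehat\omega\in\Gamma(\widehat X,\mathsf{Sym}^{l_2}\Omega_{\mathrm{hor}}\widehat V)$. Moreover $\widehat\omega$ is the image, under the canonical injection (pull-back by $\pi$) $$\Gamma\big(X,\mathsf{Sym}^{l_2}\Omega_V(\heartsuit)\big)\hookrightarrow\Gamma\big(\widehat X,\mathsf{Sym}^{l_2}\Omega_{\mathrm{hor}}\widehat V\big),$$ of a unique global twisted regular symmetric differential $l_2$-form $\omega\in\Gamma(X,\mathsf{Sym}^{l_2}\Omega_V(\heartsuit))$, where $$\heartsuit=\sum_{p=1}^{l_1}\deg F_{i_p}+\sum_{q=1}^{l_2}\deg F_{j_q}-\sum_{j=0}^N\lambda_j+N+1 .$$ Finally, for every homogeneous polynomial $P\in\mathbb{K}[z_0,\dots,z_N]$ one has $P\,\omega\in\Gamma(X,\mathsf{Sym}^{l_2}\Omega_V(\deg P+\heartsuit))$. -/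

import Mathlib

open MvPolynomial
open scoped LinearAlgebra.Projectivization TensorProduct

namespace SymForm

section Geometry

variable {K : Type*} [Field K] {N : ℕ} {ι : Type*}

/-- The differential `dP|_z = ∑ₖ (∂P/∂zₖ)(z) dzₖ` of a polynomial at a point of `K^{N+1}`. -/
noncomputable def diffAt (P : MvPolynomial (Fin (N + 1)) K) (z : Fin (N + 1) → K) :
    Module.Dual K (Fin (N + 1) → K) :=
  ∑ k, eval z (pderiv k P) • (LinearMap.proj k : (Fin (N + 1) → K) →ₗ[K] K)

/-- The closed subvariety of `ℙ^N` cut out by the homogeneous polynomials `F i`. -/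
def zeroLocus (F : ι → MvPolynomial (Fin (N + 1)) K) : Set (ℙ K (Fin (N + 1) → K)) :=
  {x | ∀ i, ∀ z ∈ x.submodule, eval z (F i) = 0}

/-- The cone `π⁻¹(Y) ⊆ K^{N+1} ∖ {0}` over a subset `Y` of `ℙ^N`. -/
def cone (Y : Set (ℙ K (Fin (N + 1) → K))) : Set (Fin (N + 1) → K) :=
  {z | ∃ hz : z ≠ 0, Projectivization.mk K z hz ∈ Y}

theorem cone_ne_zero {Y : Set (ℙ K (Fin (N + 1) → K))} (z : cone Y) : (z : Fin (N + 1) → K) ≠ 0 :=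
  z.2.choose

theorem cone_mk_mem {Y : Set (ℙ K (Fin (N + 1) → K))} (z : cone Y) :
    Projectivization.mk K z.1 (cone_ne_zero z) ∈ Y :=
  z.2.choose_spec

/-- The intersection of the hypersurfaces `F i = 0` is a smooth complete intersection
(Jacobian criterion: the differentials `dF i` are linearly independent at every point). -/
def IsSmoothCompleteIntersection (F : ι → MvPolynomial (Fin (N + 1)) K) : Prop :=
  ∀ z ∈ cone (zeroLocus F), LinearIndependent K fun i => diffAt (F i) z

/-- The tangent space at `z` of the cone over `V = {F i = 0}`:
all `ξ ∈ K^{N+1}` with `dF i|_z (ξ) = 0` for all `i`. -/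
noncomputable def coneTangent (F : ι → MvPolynomial (Fin (N + 1)) K) (z : Fin (N + 1) → K) :
    Submodule K (Fin (N + 1) → K) :=
  ⨅ i, LinearMap.ker (diffAt (F i) z)

/-- The fibre at `z` of the horizontal tangent bundle of the cone over `V = {F i = 0}`:
the classes `[ξ] ∈ K^{N+1} / K z` with `dF i|_z (ξ) = 0` for all `i`. -/
noncomputable def horTangent (F : ι → MvPolynomial (Fin (N + 1)) K) (z : Fin (N + 1) → K) :
    Submodule K ((Fin (N + 1) → K) ⧸ Submodule.span K {z}) :=
  (coneTangent F z).map (Submodule.span K {z}).mkQ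

/-- The projection `ξ ↦ [ξ]`. -/
noncomputable def toHor (F : ι → MvPolynomial (Fin (N + 1)) K) (z : Fin (N + 1) → K) :
    coneTangent F z →ₗ[K] horTangent F z :=
  (Submodule.span K {z}).mkQ.submoduleMap (coneTangent F z)

/-- The tangent space `T_V` at a point `x` of `V = {F i = 0} ⊆ ℙ^N`, `x` being the line
`L ⊆ K^{N+1}`. It is the space of all `φ ∈ Hom(L, K^{N+1}/L) = T_{ℙ^N,x}` such that, for every
`w ∈ L`, the class `φ w` is represented by a vector killed by all `dF i|_w`. The pair `(w, [ξ])`,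
identified with `(λ w, [λ ξ])`, corresponds to the homomorphism with `w ↦ [ξ]`. -/
noncomputable def tangentSpace (F : ι → MvPolynomial (Fin (N + 1)) K)
    (x : ℙ K (Fin (N + 1) → K)) :
    Submodule K (x.submodule →ₗ[K] (Fin (N + 1) → K) ⧸ x.submodule) where
  carrier := {φ | ∀ w : x.submodule, φ w ∈ (coneTangent F w.1).map x.submodule.mkQ}
  add_mem' := fun ha hb w => Submodule.add_mem _ (ha w) (hb w)
  zero_mem' := fun _ => Submodule.zero_mem _
  smul_mem' := fun a _ h w => Submodule.smul_mem _ a (h w)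

theorem eval_smul_of_isHomogeneous {P : MvPolynomial (Fin (N + 1)) K} {m : ℕ}
    (hP : P.IsHomogeneous m) (a : K) (z : Fin (N + 1) → K) :
    eval (a • z) P = a ^ m * eval z P := by
  rw [eval_eq', eval_eq', Finset.mul_sum]
  refine Finset.sum_congr rfl fun s hs => ?_
  have h : ∑ i, s i = m := by
    have := hP (mem_support_iff.mp hs)
    rw [Finsupp.weight_apply, Finsupp.sum_fintype _ _ (by simp)] at this
    simpa using this
  simp only [Pi.smul_apply, smul_eq_mul, mul_pow, Finset.prod_mul_distrib, Finset.prod_pow_eq_pow_sum]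
  rw [h]; ring

theorem diffAt_smul {P : MvPolynomial (Fin (N + 1)) K} {m : ℕ}
    (hP : P.IsHomogeneous m) (a : K) (z : Fin (N + 1) → K) :
    diffAt P (a • z) = a ^ (m - 1) • diffAt P z := by
  simp only [diffAt, Finset.smul_sum, smul_smul]
  refine Finset.sum_congr rfl fun k _ => ?_
  rw [eval_smul_of_isHomogeneous hP.pderiv]

theorem coneTangent_le_smul {F : ι → MvPolynomial (Fin (N + 1)) K} {d : ι → ℕ}
    (hF : ∀ i, (F i).IsHomogeneous (d i)) (a : K) (z : Fin (N + 1) → K) :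
    coneTangent F z ≤ coneTangent F (a • z) := by
  intro ξ hξ
  simp only [coneTangent, Submodule.mem_iInf, LinearMap.mem_ker] at hξ ⊢
  intro i
  rw [diffAt_smul (hF i), LinearMap.smul_apply, hξ i, smul_zero]

/-- The homomorphism `L → K^{N+1}/L` on the line `L = K z` which sends `z` to the class of `ξ`,
as a linear function of `[ξ] ∈ K^{N+1} / K z`. -/
noncomputable def homOfHor (z : Fin (N + 1) → K) (hz : z ≠ 0) :
    ((Fin (N + 1) → K) ⧸ Submodule.span K {z}) →ₗ[K]
      ((Projectivization.mk K z hz).submodule →ₗ[K]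
        (Fin (N + 1) → K) ⧸ (Projectivization.mk K z hz).submodule) :=
  LinearMap.smulRightₗ ((LinearEquiv.coord K _ z hz).toLinearMap ∘ₗ
      (LinearEquiv.ofEq _ _ (Projectivization.submodule_mk z hz)).toLinearMap) ∘ₗ
    Submodule.mapQ _ _ LinearMap.id (Projectivization.submodule_mk z hz).ge

/-- The isomorphism `(z, [ξ]) ↦ (z, [ξ])/∼` from the fibre of the horizontal tangent bundle of the
cone at `z` to the tangent space of `V` at `[z]`; that is, the differential of `π` at `z`. -/
noncomputable def horToTangent {F : ι → MvPolynomial (Fin (N + 1)) K} {d : ι → ℕ}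
    (hF : ∀ i, (F i).IsHomogeneous (d i)) (z : Fin (N + 1) → K) (hz : z ≠ 0) :
    horTangent F z →ₗ[K] tangentSpace F (Projectivization.mk K z hz) :=
  ((homOfHor z hz) ∘ₗ (horTangent F z).subtype).codRestrict _ (by
    rintro ⟨_, ξ, hξ, rfl⟩ ⟨w, hw⟩
    have hw' : w ∈ Submodule.span K {z} := by rwa [Projectivization.submodule_mk] at hw
    obtain ⟨a, rfl⟩ := Submodule.mem_span_singleton.mp hw'
    refine ⟨LinearEquiv.coord K _ z hz ⟨a • z, hw'⟩ • ξ,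
      Submodule.smul_mem _ _ (coneTangent_le_smul hF a z hξ), ?_⟩
    rw [map_smul]
    rfl)

end Geometry

section SymmetricPowers

variable {K : Type*} [CommRing K] {W W' : Type*} [AddCommGroup W] [Module K W]
  [AddCommGroup W'] [Module K W']

/-- The symmetric power `Sym^l W`, as the degree `l` part of the symmetric algebra of `W`. -/
noncomputable abbrev SymPow (K : Type*) [CommRing K] (l : ℕ) (W : Type*) [AddCommGroup W]
    [Module K W] : Submodule K (SymmetricAlgebra K W) :=
  LinearMap.range (SymmetricAlgebra.ι K W) ^ l

/-- Functoriality of the symmetric algebra. -/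
noncomputable def symMap (f : W →ₗ[K] W') : SymmetricAlgebra K W →ₐ[K] SymmetricAlgebra K W' :=
  SymmetricAlgebra.lift (SymmetricAlgebra.ι K W' ∘ₗ f)

theorem symMap_mem (l : ℕ) (f : W →ₗ[K] W') {s : SymmetricAlgebra K W} (hs : s ∈ SymPow K l W) :
    symMap f s ∈ SymPow K l W' := by
  have h : Submodule.map (symMap f).toLinearMap (SymPow K l W) ≤ SymPow K l W' := by
    rw [Submodule.map_pow]
    refine pow_le_pow_left' ?_ l
    rintro _ ⟨_, ⟨w, rfl⟩, rfl⟩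
    exact ⟨f w, by simp [symMap]⟩
  exact h ⟨s, hs, rfl⟩

/-- Functoriality of the symmetric power. -/
noncomputable def symPowMap (l : ℕ) (f : W →ₗ[K] W') : SymPow K l W →ₗ[K] SymPow K l W' :=
  (symMap f).toLinearMap.restrict fun _ hs => symMap_mem l f hs

end SymmetricPowers

section Sections

variable {K : Type*} [Field K] {N : ℕ} {ι : Type*}

/-- The fibre of the line bundle `𝒪(k)` at a point `x` of `ℙ^N`: the functions `f` on `L ∖ {0}`,
`L` being the line `x`, with `f (a w) = a ^ k f w`. -/
def twistFibre (k : ℤ) (x : ℙ K (Fin (N + 1) → K)) :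
    Submodule K ({w : x.submodule // w ≠ 0} → K) where
  carrier := {f | ∀ (w w' : {w : x.submodule // w ≠ 0}) (a : K), w'.1 = a • w.1 →
    f w' = a ^ k * f w}
  add_mem' := fun hf hg w w' a h => by
    rw [Pi.add_apply, Pi.add_apply, hf w w' a h, hg w w' a h, mul_add]
  zero_mem' := fun _ _ _ _ => by simp
  smul_mem' := fun b f hf w w' a h => by
    rw [Pi.smul_apply, Pi.smul_apply, hf w w' a h, smul_eq_mul, smul_eq_mul, mul_left_comm]

/-- Evaluation of elements of the fibre of `𝒪(k)` at `[z]` at the vector `z`. -/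
def evalTwist (k : ℤ) (z : Fin (N + 1) → K) (hz : z ≠ 0) :
    twistFibre k (Projectivization.mk K z hz) →ₗ[K] K :=
  (LinearMap.proj (⟨⟨z, by
      rw [Projectivization.submodule_mk]; exact Submodule.mem_span_singleton_self z⟩,
      fun h => hz (congrArg Subtype.val h)⟩ :
        {w : (Projectivization.mk K z hz).submodule // w ≠ 0})) ∘ₗ
    (twistFibre k (Projectivization.mk K z hz)).subtype

/-- The fibre at `x` of `Sym^l Ω_V (k) = Sym^l Ω_V ⊗ 𝒪(k)`, where `V = {F i = 0}`. -/
abbrev TwistedSymFibre (F : ι → MvPolynomial (Fin (N + 1)) K) (l : ℕ) (k : ℤ)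
    (x : ℙ K (Fin (N + 1) → K)) : Type _ :=
  SymPow K l (Module.Dual K (tangentSpace F x)) ⊗[K] twistFibre k x

/-- The fibre at `z` of `Sym^l Ω_hor` of the cone over `V = {F i = 0}`. -/
abbrev HorSymFibre (F : ι → MvPolynomial (Fin (N + 1)) K) (l : ℕ) (z : Fin (N + 1) → K) :
    Type _ :=
  SymPow K l (Module.Dual K (horTangent F z))

/-- Pull-back along `π`, from the fibre of `Sym^l Ω_V (k)` at `[z]` to the fibre at `z` of
`Sym^l Ω_hor` of the cone over `V`. -/
noncomputable def pullbackAt {F : ι → MvPolynomial (Fin (N + 1)) K} {d : ι → ℕ}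
    (hF : ∀ i, (F i).IsHomogeneous (d i)) (l : ℕ) (k : ℤ) (z : Fin (N + 1) → K) (hz : z ≠ 0) :
    TwistedSymFibre F l k (Projectivization.mk K z hz) →ₗ[K] HorSymFibre F l z :=
  (TensorProduct.rid K _).toLinearMap ∘ₗ
    TensorProduct.map (symPowMap l (horToTangent hF z hz).dualMap) (evalTwist k z hz)

/-- The map `ω ↦ π^* ω` from families of elements of the fibres of `Sym^l Ω_V (k)` over `Y ⊆ V` to
families of elements of the fibres of `Sym^l Ω_hor` over the cone of `Y`. Restricted to regular
sections, it is the canonical injection. -/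
noncomputable def pullback {F : ι → MvPolynomial (Fin (N + 1)) K} {d : ι → ℕ}
    (hF : ∀ i, (F i).IsHomogeneous (d i)) {l : ℕ} {k : ℤ} {Y : Set (ℙ K (Fin (N + 1) → K))}
    (ω : ∀ x : Y, TwistedSymFibre F l k x.1) (z : cone Y) : HorSymFibre F l z.1 :=
  pullbackAt hF l k z.1 (cone_ne_zero z) (ω ⟨_, cone_mk_mem z⟩)

/-- For a polynomial `Q = ∑_α q_α(z) T^α`, the element `∑_α q_α(z) (dz)^α` of the symmetric algebra
of the dual of a space `S` of vectors `ξ ∈ K^{N+1}`, where `dzᵢ` is restricted to `S`. -/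
noncomputable def formAt (Q : MvPolynomial (Fin (N + 1)) (MvPolynomial (Fin (N + 1)) K))
    (z : Fin (N + 1) → K) (S : Submodule K (Fin (N + 1) → K)) :
    SymmetricAlgebra K (Module.Dual K S) :=
  aeval (fun i => SymmetricAlgebra.ι K (Module.Dual K S)
    ((LinearMap.proj i : (Fin (N + 1) → K) →ₗ[K] K) ∘ₗ S.subtype)) (MvPolynomial.map (eval z) Q)

/-- `Γ(Ŷ, Sym^l Ω_hor V̂)`: the families `Φ` which, near every point of the cone `Ŷ` of `Y`, can be
written `∑_{|α| = l} f_α (dz)^α` with regular functions `f_α = q_α / h`. -/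
def horSections (F : ι → MvPolynomial (Fin (N + 1)) K) (l : ℕ)
    (Y : Set (ℙ K (Fin (N + 1) → K))) : Set (∀ z : cone Y, HorSymFibre F l z.1) :=
  {Φ | ∀ z₀ : cone Y, ∃ (h : MvPolynomial (Fin (N + 1)) K)
      (Q : MvPolynomial (Fin (N + 1)) (MvPolynomial (Fin (N + 1)) K)),
      Q.IsHomogeneous l ∧ eval z₀.1 h ≠ 0 ∧ ∀ z : cone Y, eval z.1 h ≠ 0 →
        symMap (toHor F z.1).dualMap (Φ z).1 =
          (eval z.1 h)⁻¹ • formAt Q z.1 (coneTangent F z.1)}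

/-- The tangent space at `z`, `z j = 1`, of the affine chart `{z j = 1}` of `V = {F i = 0}`. -/
noncomputable def affineTangent (F : ι → MvPolynomial (Fin (N + 1)) K) (j : Fin (N + 1))
    (z : Fin (N + 1) → K) : Submodule K (Fin (N + 1) → K) :=
  coneTangent F z ⊓ LinearMap.ker (LinearMap.proj j : (Fin (N + 1) → K) →ₗ[K] K)

/-- The identification of the tangent space of the affine chart with the horizontal tangent
space. -/
noncomputable def affineToHor (F : ι → MvPolynomial (Fin (N + 1)) K) (j : Fin (N + 1))
    (z : Fin (N + 1) → K) : affineTangent F j z →ₗ[K] horTangent F z :=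
  toHor F z ∘ₗ Submodule.inclusion inf_le_left

/-- `Γ(Y, Sym^l Ω_V (k))`: the families `ω` that are regular in each of the standard affine charts
`{z j ≠ 0} ≅ {z j = 1}` of `ℙ^N`. Here `𝒪(k)` is trivialised over the chart by `(z j) ^ k`, that is,
by evaluation at the representative with `z j = 1`, and regular means: near every point of the chart,
`ω = ∑_{|α| = l} f_α (dz)^α` with regular functions `f_α = q_α / h` of the affine coordinates. -/
def twistedSections {F : ι → MvPolynomial (Fin (N + 1)) K} {d : ι → ℕ}
    (hF : ∀ i, (F i).IsHomogeneous (d i)) (l : ℕ) (k : ℤ) (Y : Set (ℙ K (Fin (N + 1) → K))) :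
    Set (∀ x : Y, TwistedSymFibre F l k x.1) :=
  {ω | ∀ (j : Fin (N + 1)) (z₀ : cone Y), z₀.1 j = 1 →
      ∃ (h : MvPolynomial (Fin (N + 1)) K)
        (Q : MvPolynomial (Fin (N + 1)) (MvPolynomial (Fin (N + 1)) K)),
        Q.IsHomogeneous l ∧ eval z₀.1 h ≠ 0 ∧
          ∀ z : cone Y, z.1 j = 1 → eval z.1 h ≠ 0 →
            symMap (affineToHor F j z.1).dualMap (pullback hF ω z).1 =
              (eval z.1 h)⁻¹ • formAt Q z.1 (affineTangent F j z.1)}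

/-- Multiplication by a homogeneous polynomial `P` of degree `e`, `𝒪(k) → 𝒪(e + k)`, on fibres. -/
noncomputable def mulTwist {P : MvPolynomial (Fin (N + 1)) K} {e : ℕ} (hP : P.IsHomogeneous e)
    (k : ℤ) (x : ℙ K (Fin (N + 1) → K)) : twistFibre k x →ₗ[K] twistFibre ((e : ℤ) + k) x where
  toFun f := ⟨fun w => eval w.1.1 P * f.1 w, fun w w' a h => by
    have ha : a ≠ 0 := by
      rintro rfl
      exact w'.2 (by rw [h, zero_smul])
    change eval w'.1.1 P * f.1 w' = a ^ ((e : ℤ) + k) * (eval w.1.1 P * f.1 w)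
    rw [f.2 w w' a h, h, Submodule.coe_smul, eval_smul_of_isHomogeneous hP, zpow_add₀ ha,
      zpow_natCast]
    ring⟩
  map_add' f g := by ext w; simp [mul_add]
  map_smul' b f := by ext w; simp [mul_left_comm]

/-- The product `P ω` of a family of elements of the fibres of `Sym^l Ω_V (k)` with a homogeneous
polynomial `P` of degree `e`. -/
noncomputable def mulSection {F : ι → MvPolynomial (Fin (N + 1)) K}
    {P : MvPolynomial (Fin (N + 1)) K} {e : ℕ} (hP : P.IsHomogeneous e) {l : ℕ} {k : ℤ}
    {Y : Set (ℙ K (Fin (N + 1) → K))} (ω : ∀ x : Y, TwistedSymFibre F l k x.1) (x : Y) :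
    TwistedSymFibre F l ((e : ℤ) + k) x.1 :=
  (mulTwist hP k x.1).lTensor _ (ω x)

end Sections

section Fermat

variable {K : Type*} [Field K] {N : ℕ}

/-- The Fermat-type polynomials `Fᵢ = ∑ⱼ Aᵢʲ zⱼ^{λⱼ}`. -/
noncomputable def fermat {m : ℕ} (lam : Fin (N + 1) → ℕ)
    (A : Fin m → Fin (N + 1) → MvPolynomial (Fin (N + 1)) K) (i : Fin m) :
    MvPolynomial (Fin (N + 1)) K :=
  ∑ j, A i j * X j ^ lam j

theorem fermat_isHomogeneous {m : ℕ} {lam : Fin (N + 1) → ℕ} {d : Fin m → ℕ}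
    {A : Fin m → Fin (N + 1) → MvPolynomial (Fin (N + 1)) K} (hlam : ∀ i j, lam j ≤ d i)
    (hA : ∀ i j, (A i j).IsHomogeneous (d i - lam j)) (i : Fin m) :
    (fermat lam A i).IsHomogeneous (d i) := by
  refine IsHomogeneous.sum _ _ _ fun j _ => ?_
  have h := (hA i j).mul (isHomogeneous_X_pow j (lam j) (R := K))
  rwa [Nat.sub_add_cancel (hlam i j)] at h

/-- The first `c` of the polynomials `Fᵢ`, which define `V`. -/
noncomputable def fermatV {c r : ℕ} (lam : Fin (N + 1) → ℕ)
    (A : Fin (c + r) → Fin (N + 1) → MvPolynomial (Fin (N + 1)) K) (i : Fin c) :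
    MvPolynomial (Fin (N + 1)) K :=
  fermat lam A (Fin.castAdd r i)

theorem fermatV_isHomogeneous {c r : ℕ} {lam : Fin (N + 1) → ℕ} {d : Fin (c + r) → ℕ}
    {A : Fin (c + r) → Fin (N + 1) → MvPolynomial (Fin (N + 1)) K} (hlam : ∀ i j, lam j ≤ d i)
    (hA : ∀ i j, (A i j).IsHomogeneous (d i - lam j)) (i : Fin c) :
    (fermatV lam A i).IsHomogeneous (d (Fin.castAdd r i)) :=
  fermat_isHomogeneous hlam hA (Fin.castAdd r i)

/-- The matrix `C` at the point `z`, with `c + r` upper rows `Ãᵢʲ = Aᵢʲ zⱼ` and `c` lower rows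
`Bᵢʲ = zⱼ dAᵢʲ + λⱼ Aᵢʲ dzⱼ`, and columns `j = 0, …, N`; its entries are symmetric forms on
`K^{N+1}` of degree `0` and `1`. -/
noncomputable def matC {c r : ℕ} (lam : Fin (N + 1) → ℕ)
    (A : Fin (c + r) → Fin (N + 1) → MvPolynomial (Fin (N + 1)) K) (z : Fin (N + 1) → K) :
    Matrix (Fin (c + r) ⊕ Fin c) (Fin (N + 1))
      (SymmetricAlgebra K (Module.Dual K (Fin (N + 1) → K))) :=
  Matrix.of (Sum.elim
    (fun i j => algebraMap K _ (eval z (A i j) * z j))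
    (fun i j => SymmetricAlgebra.ι K (Module.Dual K (Fin (N + 1) → K))
      (z j • diffAt (A (Fin.castAdd r i) j) z +
        ((lam j : K) * eval z (A (Fin.castAdd r i) j)) •
          (LinearMap.proj j : (Fin (N + 1) → K) →ₗ[K] K))))

/-- The form `(-1)ʲ / zⱼ^{λⱼ - 1} · det Ĉⱼ` at `z`, where `Ĉⱼ` consists of the upper rows
`i₁, …, i_{l₁}` and the lower rows `j₁, …, j_{l₂}` of `C`, without the column `j`. -/
noncomputable def cramerForm {c r l₁ l₂ : ℕ} (lam : Fin (N + 1) → ℕ)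
    (A : Fin (c + r) → Fin (N + 1) → MvPolynomial (Fin (N + 1)) K) (hl : l₁ + l₂ = N)
    (i : Fin l₁ → Fin (c + r)) (j : Fin l₂ → Fin c) (s : Fin (N + 1)) (z : Fin (N + 1) → K) :
    SymmetricAlgebra K (Module.Dual K (Fin (N + 1) → K)) :=
  ((-1) ^ (s : ℕ) / z s ^ (lam s - 1)) •
    ((matC lam A z).submatrix
      (fun p : Fin N => Fin.append (Sum.inl ∘ i) (Sum.inr ∘ j) (Fin.cast hl.symm p))
      s.succAbove).det

/-- `♥ = ∑ deg F_{i_p} + ∑ deg F_{j_q} - ∑ λⱼ + N + 1`, where `deg Fᵢ = d i`. -/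
def heart {c r l₁ l₂ : ℕ} (lam : Fin (N + 1) → ℕ) (d : Fin (c + r) → ℕ)
    (i : Fin l₁ → Fin (c + r)) (j : Fin l₂ → Fin c) : ℤ :=
  ∑ p, (d (i p) : ℤ) + ∑ q, (d (Fin.castAdd r (j q)) : ℤ) - ∑ s, (lam s : ℤ) + N + 1

/-- On each open set `{z s ≠ 0}` of the cone over `X = {Fᵢ = 0 ∀ i}`, the horizontal form `Φ` is
induced by the form `(-1)ˢ / zₛ^{λₛ - 1} · det Ĉₛ`: the two agree after pull-back to the tangent
spaces of the cone over `V` (an injective operation). -/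
def IsGlued {c r l₁ l₂ : ℕ} (lam : Fin (N + 1) → ℕ)
    (A : Fin (c + r) → Fin (N + 1) → MvPolynomial (Fin (N + 1)) K) (hl : l₁ + l₂ = N)
    (i : Fin l₁ → Fin (c + r)) (j : Fin l₂ → Fin c)
    (Φ : ∀ z : cone (zeroLocus (fermat lam A)), HorSymFibre (fermatV lam A) l₂ z.1) : Prop :=
  ∀ (s : Fin (N + 1)) (z : cone (zeroLocus (fermat lam A))), z.1 s ≠ 0 →
    symMap (toHor (fermatV lam A) z.1).dualMap (Φ z).1 =
      symMap (coneTangent (fermatV lam A) z.1).subtype.dualMap (cramerForm lam A hl i j s z.1)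

end Fermat

end SymForm

/-! The gluing is Cramer's rule. On the cone over `X` the vector `v = (z_k ^ (λ_k - 1))` is killed
by every upper row of `C`, since that combination is `F_i(z) = 0`. By the product rule the same
combination of a lower row is `dF_i`, which vanishes on vectors tangent to the cone over `V`. So
after restriction to `coneTangent` the selected `N × (N + 1)` matrix kills `v`, and its signed
maximal minors are proportional to `v` (`mul_minor_eq_of_mulVec_eq_zero`, valid over any commutative
ring). Dividing the `s`-th minor by `v_s` therefore gives a form that does not depend on `s`
(`cramerForm_glue`). It is regular because only `z_s` is inverted.

The form is horizontal by Euler's identity: replacing `ξ` by `ξ + ε z` adds to the lower row of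
index `i` the multiple `d_i ε` of the upper row of index `i`. Since each `j_q` occurs among the
`i_p`, that upper row belongs to the same minor, and the determinant is unchanged
(`symMap_cramerForm_of_sub_mem`).

The twist is a count of weights. Replacing `z` by `a z` scales the rows and columns of the minor, so
the Cramer form acquires the factor `a ^ (♥ - l₂)` (`cramerForm_smul`). A pulled-back element of
`Sym^l Ω_V (k)` acquires `a ^ (k - l)`: the twist gives `a ^ k`, and each of the `l` cotangent
factors gives `a⁻¹`, because `ξ` at `a z` and `a⁻¹ ξ` at `z` represent the same tangent vector.
Pull-back is bijective on fibres, so a family on the cone descends exactly when it scales in this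
way (`exists_pullback_eq`), here with `k = ♥`.

Forms are compared throughout on `coneTangent` instead of its quotient `horTangent`. Nothing is
lost, since a surjection of vector spaces induces an injection on symmetric algebras of duals
(`symMap_dualMap_injective`). -/

namespace SymForm

/-! ### Determinants: Cramer's rule, row operations and rescaling. -/

section Matrices

variable {R : Type*} [CommRing R]

/-- If a vector `v` is killed by an `n × (n + 1)` matrix, its entries are proportional to the
signed maximal minors of the matrix. -/
theorem mul_minor_eq_of_mulVec_eq_zero {n : ℕ} (M : Matrix (Fin n) (Fin (n + 1)) R)
    (v : Fin (n + 1) → R) (hv : M.mulVec v = 0) (s t : Fin (n + 1)) :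
    v t * ((-1) ^ (s : ℕ) * (M.submatrix id s.succAbove).det) =
      v s * ((-1) ^ (t : ℕ) * (M.submatrix id t.succAbove).det) := by
  -- Border `M` by the basis row `e_s` on top. The signed minors form column `0` of the adjugate,
  -- the determinant is the `s`-th signed minor, and `M' v = v_s e_0`. The claim is then coordinate
  -- `t` of `det M' • v = adj M' (M' v)`.
  let M' : Matrix (Fin (n + 1)) (Fin (n + 1)) R := Matrix.of (Fin.cons (Pi.single s 1) M)
  have hM0 : M' 0 = Pi.single s 1 := rfl
  have hMsucc : ∀ k : Fin n, M' k.succ = M k := fun _ => rfl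
  have hadj : ∀ k, M'.adjugate k 0 = (-1) ^ (k : ℕ) * (M.submatrix id k.succAbove).det := by
    intro k
    rw [Matrix.adjugate_fin_succ_eq_det_submatrix]
    simp only [Fin.val_zero, zero_add]
    congr 2
  have hdet : M'.det = (-1) ^ (s : ℕ) * (M.submatrix id s.succAbove).det := by
    have h := congrFun (congrFun (Matrix.mul_adjugate M') 0) 0
    rw [Matrix.mul_apply] at h
    simp only [Matrix.smul_apply, Matrix.one_apply_eq, smul_eq_mul, mul_one] at h
    rw [← h, Finset.sum_eq_single s, hadj]
    · simp [hM0]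
    · intro b _ hb
      simp [hM0, hb]
    · simp
  have hM'v : M'.mulVec v = Pi.single 0 (v s) := by
    funext k
    refine Fin.cases ?_ (fun k => ?_) k
    · simp [hM0, Matrix.mulVec]
    · simpa [hMsucc, Matrix.mulVec] using congrFun hv k
  have key : M'.det • v = M'.adjugate.mulVec (M'.mulVec v) := by
    rw [Matrix.mulVec_mulVec, Matrix.adjugate_mul, Matrix.smul_mulVec, Matrix.one_mulVec]
  have h := congrFun key t
  rw [hM'v] at h
  simp only [Pi.smul_apply, smul_eq_mul, Matrix.mulVec_single, Matrix.col_apply] at h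
  rw [hadj, hdet] at h
  rw [mul_comm, h, op_smul_eq_smul, smul_eq_mul]

/-- Adding multiples of upper rows to the lower rows does not change the determinant. -/
theorem det_append_add {n l₁ l₂ : ℕ} (hl : l₁ + l₂ = n) (U : Fin l₁ → Fin n → R)
    (B : Fin l₂ → Fin n → R) (τ : Fin l₂ → Fin l₁) (a : Fin l₂ → R) :
    (Matrix.of fun p : Fin n =>
        Fin.append U (fun q => B q + a q • U (τ q)) (Fin.cast hl.symm p)).det =
      (Matrix.of fun p : Fin n => Fin.append U B (Fin.cast hl.symm p)).det := by
  subst hl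
  rw [← Matrix.det_submatrix_equiv_self finSumFinEquiv,
    ← Matrix.det_submatrix_equiv_self (finSumFinEquiv (m := l₁) (n := l₂))
      (Matrix.of fun p => Fin.append U B (Fin.cast _ p))]
  set M₁ := (Matrix.of fun p : Fin (l₁ + l₂) => Fin.append U B (Fin.cast rfl p)).submatrix
    finSumFinEquiv finSumFinEquiv with hM₁
  -- The row operation is left multiplication by a block lower triangular matrix with identity
  -- diagonal blocks, hence of determinant `1`.
  have h : (Matrix.of fun p : Fin (l₁ + l₂) =>
      Fin.append U (fun q => B q + a q • U (τ q)) (Fin.cast rfl p)).submatrix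
        finSumFinEquiv finSumFinEquiv =
      Matrix.fromBlocks 1 0 (Matrix.of fun q p => if p = τ q then a q else 0) 1 * M₁ := by
    ext (p | q) k
    · simp [hM₁, Matrix.mul_apply, Fintype.sum_sum_type, Matrix.one_apply]
    · simp [hM₁, Matrix.mul_apply, Fintype.sum_sum_type, Matrix.one_apply, add_comm]
  rw [h, Matrix.det_mul, Matrix.det_fromBlocks_zero₁₂]
  simp

theorem det_smul_smul {k : Type*} [CommRing k] [Algebra k R] {n : Type*} [Fintype n]
    [DecidableEq n] (M : Matrix n n R) (u v : n → k) :
    (Matrix.of fun p q => (u p * v q) • M p q).det = ((∏ p, u p) * ∏ q, v q) • M.det := by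
  have h : (Matrix.of fun p q => (u p * v q) • M p q) =
      Matrix.of fun p q => algebraMap k R (u p) *
        (Matrix.of fun p q => algebraMap k R (v q) * M p q) p q := by
    ext p q
    simp [Algebra.smul_def, mul_assoc]
  rw [h, Matrix.det_mul_column, Matrix.det_mul_row, ← mul_assoc, ← map_prod, ← map_prod,
    ← map_mul, Algebra.smul_def]

theorem prod_zpow_eq_zpow_sum {k σ : Type*} [Field k] {a : k} (ha : a ≠ 0) (s : Finset σ)
    (e : σ → ℤ) : ∏ x ∈ s, a ^ e x = a ^ ∑ x ∈ s, e x := by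
  induction s using Finset.cons_induction with
  | empty => simp
  | cons b s hb ih => rw [Finset.prod_cons, Finset.sum_cons, ih, zpow_add₀ ha]

end Matrices

/-! ### Functoriality of symmetric algebras and symmetric powers. -/

section SymmetricPowers

variable {K : Type*} [CommRing K] {W W' W'' : Type*} [AddCommGroup W] [Module K W]
  [AddCommGroup W'] [Module K W'] [AddCommGroup W''] [Module K W'']

@[simp]
theorem symMap_ι (f : W →ₗ[K] W') (w : W) :
    symMap f (SymmetricAlgebra.ι K W w) = SymmetricAlgebra.ι K W' (f w) := by
  simp [symMap]

theorem symMap_symMap (g : W' →ₗ[K] W'') (f : W →ₗ[K] W') (s : SymmetricAlgebra K W) :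
    symMap g (symMap f s) = symMap (g ∘ₗ f) s := by
  have h : (symMap g).comp (symMap f) = symMap (g ∘ₗ f) := by
    apply SymmetricAlgebra.algHom_ext
    ext w
    simp
  exact DFunLike.congr_fun h s

theorem symMap_id (s : SymmetricAlgebra K W) : symMap LinearMap.id s = s := by
  have h : symMap (LinearMap.id : W →ₗ[K] W) = AlgHom.id K _ := by
    apply SymmetricAlgebra.algHom_ext
    ext w
    simp
  exact DFunLike.congr_fun h s

theorem symMap_injective_of_comp_eq_id {f : W →ₗ[K] W'} {g : W' →ₗ[K] W}
    (h : g ∘ₗ f = LinearMap.id) : Function.Injective (symMap f) :=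
  Function.LeftInverse.injective (g := symMap g) fun s => by rw [symMap_symMap, h, symMap_id]

/-- Each of the `l` linear factors contributes one `a`. This is the source of the shift by `l` in
the weights `k - l` below. -/
theorem symMap_smul (a : K) (f : W →ₗ[K] W') {l : ℕ} {s : SymmetricAlgebra K W}
    (hs : s ∈ SymPow K l W) : symMap (a • f) s = a ^ l • symMap f s := by
  induction hs using Submodule.pow_induction_on_left' with
  | algebraMap r => simp
  | add x y i hx hy ihx ihy => rw [map_add, map_add, ihx, ihy, smul_add]
  | mem_mul m hm i x hx ih =>
    obtain ⟨w, rfl⟩ := hm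
    rw [map_mul, map_mul, ih, symMap_ι, symMap_ι, LinearMap.smul_apply, map_smul, pow_succ',
      smul_mul_smul_comm]

theorem symPowMap_bijective {f : W →ₗ[K] W'} {g : W' →ₗ[K] W} (hgf : g ∘ₗ f = LinearMap.id)
    (hfg : f ∘ₗ g = LinearMap.id) (l : ℕ) : Function.Bijective (symPowMap l f) := by
  refine ⟨fun s t hst => ?_, fun t => ⟨symPowMap l g t, ?_⟩⟩
  · exact Subtype.ext (symMap_injective_of_comp_eq_id hgf (congrArg Subtype.val hst))
  · refine Subtype.ext ?_
    change symMap f (symMap g t.1) = t.1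
    rw [symMap_symMap, hfg, symMap_id]

theorem aeval_mem_symPow {σ : Type*} {Q : MvPolynomial σ K} {l : ℕ} (hQ : Q.IsHomogeneous l)
    (v : σ → W) : aeval (fun i => SymmetricAlgebra.ι K W (v i)) Q ∈ SymPow K l W := by
  rw [aeval_def, eval₂_eq]
  refine Submodule.sum_mem _ fun m hm => ?_
  rw [← Algebra.smul_def]
  refine Submodule.smul_mem _ _ ?_
  have hdeg : ∑ i ∈ m.support, m i = l := by
    have := hQ (mem_support_iff.mp hm)
    rw [Finsupp.weight_apply] at this
    simpa [Finsupp.sum] using this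
  rw [← hdeg]
  generalize m.support = t
  induction t using Finset.cons_induction with
  | empty => simp
  | cons a t ha ih =>
    rw [Finset.prod_cons, Finset.sum_cons, SymPow, pow_add]
    exact Submodule.mul_mem_mul (Submodule.pow_mem_pow _ (LinearMap.mem_range_self _ (v a)) _) ih

end SymmetricPowers

section VectorSpaces

variable {K : Type*} [Field K] {W W' : Type*} [AddCommGroup W] [Module K W]
  [AddCommGroup W'] [Module K W']

/-- A linear section of `f` dualises to a left inverse of `f.dualMap`, and functoriality carries it
to the symmetric algebras. -/
theorem symMap_dualMap_injective {f : W →ₗ[K] W'} (hf : Function.Surjective f) :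
    Function.Injective (symMap f.dualMap) := by
  obtain ⟨g, hg⟩ := f.exists_rightInverse_of_surjective (LinearMap.range_eq_top.mpr hf)
  refine symMap_injective_of_comp_eq_id (g := g.dualMap) ?_
  rw [LinearMap.dualMap_comp_dualMap, hg, LinearMap.dualMap_id]

theorem symPowMap_dualMap_bijective {f : W →ₗ[K] W'} (hf : Function.Bijective f) (l : ℕ) :
    Function.Bijective (symPowMap l f.dualMap) := by
  let e := LinearEquiv.ofBijective f hf
  have he : e.toLinearMap = f := rfl
  refine symPowMap_bijective (g := e.symm.toLinearMap.dualMap) ?_ ?_ l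
  · rw [LinearMap.dualMap_comp_dualMap, ← he]; simp
  · rw [LinearMap.dualMap_comp_dualMap, ← he]; simp

theorem symMap_inclusion_subtype {S T : Submodule K W} (h : S ≤ T)
    (s : SymmetricAlgebra K (Module.Dual K W)) :
    symMap (Submodule.inclusion h).dualMap (symMap T.subtype.dualMap s) =
      symMap S.subtype.dualMap s := by
  rw [symMap_symMap, LinearMap.dualMap_comp_dualMap]
  rfl

end VectorSpaces

/-! ### Differentials of polynomials, Euler's identity and tangent spaces. -/

section Geometry

variable {K : Type*} [Field K] {N : ℕ} {ι : Type*}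

theorem toHor_surjective (F : ι → MvPolynomial (Fin (N + 1)) K) (z : Fin (N + 1) → K) :
    Function.Surjective (toHor F z) := by
  rintro ⟨_, ξ, hξ, rfl⟩
  exact ⟨⟨ξ, hξ⟩, rfl⟩

theorem toHor_eq_zero_iff (F : ι → MvPolynomial (Fin (N + 1)) K) (z : Fin (N + 1) → K)
    (ξ : coneTangent F z) : toHor F z ξ = 0 ↔ ∃ b : K, b • z = ξ.1 := by
  rw [← Submodule.mem_span_singleton, ← Submodule.Quotient.mk_eq_zero, Subtype.ext_iff]
  rfl

theorem eval_eq_zero_of_mem_cone {F : ι → MvPolynomial (Fin (N + 1)) K}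
    (z : cone (zeroLocus F)) (i : ι) : eval z.1 (F i) = 0 := by
  refine cone_mk_mem z i z.1 ?_
  rw [Projectivization.submodule_mk]
  exact Submodule.mem_span_singleton_self _

theorem exists_ne_zero_of_mem_cone {Y : Set (ℙ K (Fin (N + 1) → K))} (z : cone Y) :
    ∃ s, z.1 s ≠ 0 :=
  Function.ne_iff.mp (cone_ne_zero z)

theorem diffAt_apply (P : MvPolynomial (Fin (N + 1)) K) (z ξ : Fin (N + 1) → K) :
    diffAt P z ξ = ∑ k, eval z (pderiv k P) * ξ k := by
  simp [diffAt, LinearMap.sum_apply]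

theorem diffAt_mul (P Q : MvPolynomial (Fin (N + 1)) K) (z : Fin (N + 1) → K) :
    diffAt (P * Q) z = eval z P • diffAt Q z + eval z Q • diffAt P z := by
  ext1 k
  ext
  simp [diffAt_apply, Derivation.leibniz, Pi.single_apply]

theorem diffAt_X_pow (k : Fin (N + 1)) (m : ℕ) (z : Fin (N + 1) → K) :
    diffAt (X k ^ m) z = ((m : K) * z k ^ (m - 1)) •
      (LinearMap.proj k : (Fin (N + 1) → K) →ₗ[K] K) := by
  ext t
  by_cases h : t = k
  · subst h
    simp [diffAt_apply, Derivation.leibniz_pow, Pi.single_apply, pderiv_X]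
  · simp [diffAt_apply, Derivation.leibniz_pow, Pi.single_apply, pderiv_X, Ne.symm h]

theorem diffAt_sum {σ : Type*} (s : Finset σ) (P : σ → MvPolynomial (Fin (N + 1)) K)
    (z : Fin (N + 1) → K) : diffAt (∑ a ∈ s, P a) z = ∑ a ∈ s, diffAt (P a) z := by
  ext t
  simp [diffAt_apply, Pi.single_apply]

/-- Euler's identity. -/
theorem diffAt_self {P : MvPolynomial (Fin (N + 1)) K} {m : ℕ} (hP : P.IsHomogeneous m)
    (z : Fin (N + 1) → K) : diffAt P z z = m * eval z P := by
  have h := congrArg (eval z) hP.sum_X_mul_pderiv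
  simp only [map_sum, map_mul, eval_X, nsmul_eq_mul, map_natCast] at h
  rw [diffAt_apply, ← h]
  exact Finset.sum_congr rfl fun _ _ => mul_comm _ _

theorem smul_diffAt_smul {P : MvPolynomial (Fin (N + 1)) K} {m : ℕ}
    (hP : P.IsHomogeneous m) (a : K) (z : Fin (N + 1) → K) :
    a • diffAt P (a • z) = a ^ m • diffAt P z := by
  rw [diffAt_smul hP, smul_smul]
  rcases m with _ | m
  -- In degree `0` the exponent `m - 1` is truncated to `0`, so the general computation fails; both
  -- sides vanish because `P` is constant.
  · have h : diffAt P z = 0 := by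
      obtain ⟨b, rfl⟩ : ∃ b, P = C b := ⟨_, (totalDegree_eq_zero_iff_eq_C.mp
        (Nat.le_zero.mp hP.totalDegree_le))⟩
      simp [diffAt]
    simp [h]
  · rw [Nat.add_sub_cancel, pow_succ']

theorem affineTangent_le (F : ι → MvPolynomial (Fin (N + 1)) K) (j : Fin (N + 1))
    (z : Fin (N + 1) → K) : affineTangent F j z ≤ coneTangent F z :=
  inf_le_left

theorem affineToHor_eq (F : ι → MvPolynomial (Fin (N + 1)) K) (j : Fin (N + 1))
    (z : Fin (N + 1) → K) (s : SymmetricAlgebra K (Module.Dual K (horTangent F z))) :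
    symMap (affineToHor F j z).dualMap s =
      symMap (Submodule.inclusion (affineTangent_le F j z)).dualMap
        (symMap (toHor F z).dualMap s) := by
  rw [symMap_symMap, LinearMap.dualMap_comp_dualMap]
  rfl

end Geometry

/-! ### Symmetric forms with polynomial coefficients. -/

section Forms

variable {K : Type*} [Field K] {N : ℕ} {ι : Type*}

/-- `formAt` as a ring homomorphism. -/
noncomputable def formHom (z : Fin (N + 1) → K) (S : Submodule K (Fin (N + 1) → K)) :
    MvPolynomial (Fin (N + 1)) (MvPolynomial (Fin (N + 1)) K) →+*
      SymmetricAlgebra K (Module.Dual K S) :=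
  (aeval (R := K) (fun i => SymmetricAlgebra.ι K (Module.Dual K S)
    ((LinearMap.proj i : (Fin (N + 1) → K) →ₗ[K] K) ∘ₗ S.subtype))).toRingHom.comp
    (MvPolynomial.map (eval z))

theorem formHom_apply (Q : MvPolynomial (Fin (N + 1)) (MvPolynomial (Fin (N + 1)) K))
    (z : Fin (N + 1) → K) (S : Submodule K (Fin (N + 1) → K)) :
    formHom z S Q = formAt Q z S :=
  rfl

theorem formAt_C_mul (P : MvPolynomial (Fin (N + 1)) K)
    (Q : MvPolynomial (Fin (N + 1)) (MvPolynomial (Fin (N + 1)) K))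
    (z : Fin (N + 1) → K) (S : Submodule K (Fin (N + 1) → K)) :
    formAt (C P * Q) z S = eval z P • formAt Q z S := by
  simp [formAt, Algebra.smul_def]

theorem formAt_mem {Q : MvPolynomial (Fin (N + 1)) (MvPolynomial (Fin (N + 1)) K)} {l : ℕ}
    (hQ : Q.IsHomogeneous l) (z : Fin (N + 1) → K) (S : Submodule K (Fin (N + 1) → K)) :
    formAt Q z S ∈ SymPow K l (Module.Dual K S) :=
  aeval_mem_symPow (hQ.map _) _

theorem symMap_inclusion_formAt {S T : Submodule K (Fin (N + 1) → K)} (h : S ≤ T)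
    (Q : MvPolynomial (Fin (N + 1)) (MvPolynomial (Fin (N + 1)) K)) (z : Fin (N + 1) → K) :
    symMap (Submodule.inclusion h).dualMap (formAt Q z T) = formAt Q z S := by
  rw [formAt, comp_aeval_apply]
  simp only [symMap_ι]
  rfl

end Forms

/-! ### The Cramer forms: regularity, gluing, horizontality and homogeneity. -/

section Fermat

variable {K : Type*} [Field K] {N : ℕ} {c r : ℕ}

/-- The matrix `C`, with polynomial entries: `T k` stands for `dz k`. -/
noncomputable def polyC (lam : Fin (N + 1) → ℕ)
    (A : Fin (c + r) → Fin (N + 1) → MvPolynomial (Fin (N + 1)) K) :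
    Matrix (Fin (c + r) ⊕ Fin c) (Fin (N + 1))
      (MvPolynomial (Fin (N + 1)) (MvPolynomial (Fin (N + 1)) K)) :=
  Matrix.of (Sum.elim
    (fun i j => C (A i j * X j))
    (fun i j => ∑ k, C (X j * pderiv k (A (Fin.castAdd r i) j)) * X k +
      C ((lam j : MvPolynomial (Fin (N + 1)) K) * A (Fin.castAdd r i) j) * X j))

theorem formAt_polyC (lam : Fin (N + 1) → ℕ)
    (A : Fin (c + r) → Fin (N + 1) → MvPolynomial (Fin (N + 1)) K) (z : Fin (N + 1) → K)
    (S : Submodule K (Fin (N + 1) → K)) (p : Fin (c + r) ⊕ Fin c) (k : Fin (N + 1)) :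
    formAt (polyC lam A p k) z S = symMap S.subtype.dualMap (matC lam A z p k) := by
  rcases p with p | p
  · simp [formAt, polyC, matC]
  · simp only [formAt, polyC, matC, Matrix.of_apply, Sum.elim_inr, map_add, map_sum, map_mul,
      map_C, aeval_C, map_X, aeval_X, eval_X, map_natCast, symMap_ι, diffAt, map_smul,
      Finset.smul_sum, smul_smul, Algebra.smul_def,
      AlgHom.commutes]
    rfl

/-- The polynomial form of `det Ĉ_s`. -/
noncomputable def polyCramer {l₁ l₂ : ℕ} (lam : Fin (N + 1) → ℕ)
    (A : Fin (c + r) → Fin (N + 1) → MvPolynomial (Fin (N + 1)) K) (hl : l₁ + l₂ = N)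
    (i : Fin l₁ → Fin (c + r)) (j : Fin l₂ → Fin c) (s : Fin (N + 1)) :
    MvPolynomial (Fin (N + 1)) (MvPolynomial (Fin (N + 1)) K) :=
  ((polyC lam A).submatrix
      (fun p : Fin N => Fin.append (Sum.inl ∘ i) (Sum.inr ∘ j) (Fin.cast hl.symm p))
      s.succAbove).det

variable {l₁ l₂ : ℕ} {lam : Fin (N + 1) → ℕ}
  {A : Fin (c + r) → Fin (N + 1) → MvPolynomial (Fin (N + 1)) K} {hl : l₁ + l₂ = N}
  {i : Fin l₁ → Fin (c + r)} {j : Fin l₂ → Fin c}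

/-- Each Leibniz term takes one entry from every row: the `l₁` upper rows have degree `0` in the
`dz_k`, the `l₂` lower rows degree `1`. -/
theorem polyCramer_isHomogeneous (s : Fin (N + 1)) :
    (polyCramer lam A hl i j s).IsHomogeneous l₂ := by
  subst hl
  rw [polyCramer, Matrix.det_apply']
  refine IsHomogeneous.sum _ _ _ fun σ _ => ?_
  have hσ : ((Equiv.Perm.sign σ : ℤ) : MvPolynomial (Fin (l₁ + l₂ + 1))
      (MvPolynomial (Fin (l₁ + l₂ + 1)) K)).IsHomogeneous 0 := by
    have h := isHomogeneous_C (Fin (l₁ + l₂ + 1))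
      (((Equiv.Perm.sign σ : ℤ) : MvPolynomial (Fin (l₁ + l₂ + 1)) K))
    rwa [map_intCast] at h
  -- Index the product by rows instead of columns, since the degree of an entry depends on its row
  -- alone.
  rw [← Equiv.prod_comp σ⁻¹]
  have h := IsHomogeneous.prod (R := MvPolynomial (Fin (l₁ + l₂ + 1)) K) Finset.univ
    (fun p : Fin (l₁ + l₂) => polyC lam A (Fin.append (Sum.inl ∘ i) (Sum.inr ∘ j) p)
      (s.succAbove (σ⁻¹ p)))
    (Fin.append (fun _ => 0) (fun _ => 1)) fun p _ => ?_
  · simp only [Fin.sum_univ_add, Fin.append_left, Fin.append_right, Finset.sum_const_zero,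
      Finset.sum_const, Finset.card_univ, Fintype.card_fin, smul_eq_mul, mul_one, zero_add] at h
    simpa using hσ.mul h
  · refine Fin.addCases (fun p => ?_) (fun p => ?_) p
    · simp only [Fin.append_left, Function.comp_apply, polyC, Matrix.of_apply, Sum.elim_inl]
      exact isHomogeneous_C _ _
    · simp only [Fin.append_right, Function.comp_apply, polyC, Matrix.of_apply, Sum.elim_inr]
      refine (IsHomogeneous.sum _ _ _ fun k _ => ?_).add ?_
      · simpa only [zero_add] using (isHomogeneous_C _ _).mul (isHomogeneous_X _ k)
      · simpa only [zero_add] using (isHomogeneous_C _ _).mul (isHomogeneous_X _ _)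

theorem formAt_polyCramer (s : Fin (N + 1)) (z : Fin (N + 1) → K)
    (S : Submodule K (Fin (N + 1) → K)) :
    symMap S.subtype.dualMap (cramerForm lam A hl i j s z) =
      ((-1) ^ (s : ℕ) / z s ^ (lam s - 1)) • formAt (polyCramer lam A hl i j s) z S := by
  rw [cramerForm, map_smul, polyCramer, ← formHom_apply, RingHom.map_det, AlgHom.map_det]
  congr 2
  ext p k
  exact (formAt_polyC lam A z S _ _).symm

theorem symMap_cramerForm_mem (s : Fin (N + 1)) (z : Fin (N + 1) → K)
    (S : Submodule K (Fin (N + 1) → K)) :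
    symMap S.subtype.dualMap (cramerForm lam A hl i j s z) ∈ SymPow K l₂ (Module.Dual K S) := by
  rw [formAt_polyCramer]
  exact Submodule.smul_mem _ _ (formAt_mem (polyCramer_isHomogeneous s) z S)

/-- The upper rows of `C` are killed by the vector `(z_k^{λ_k - 1})`. -/
theorem sum_matC_inl (hlam : ∀ k, 1 ≤ lam k) (z : cone (zeroLocus (fermat lam A)))
    (p : Fin (c + r)) :
    ∑ k, matC lam A z.1 (Sum.inl p) k * algebraMap K _ (z.1 k ^ (lam k - 1)) = 0 := by
  simp only [matC, Matrix.of_apply, Sum.elim_inl, ← map_mul, ← map_sum]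
  have h := eval_eq_zero_of_mem_cone z p
  simp only [fermat, map_sum, map_mul, map_pow, eval_X] at h
  rw [← map_zero (algebraMap K _), ← h]
  congr 1
  refine Finset.sum_congr rfl fun k _ => ?_
  rw [mul_assoc, ← pow_succ', Nat.sub_add_cancel (hlam k)]

/-- The lower rows of `C` are killed by the vector `(z_k^{λ_k - 1})` on the cone over `V`. -/
theorem sum_matC_inr (hlam : ∀ k, 1 ≤ lam k) (z : Fin (N + 1) → K) (p : Fin c) :
    ∑ k, symMap (coneTangent (fermatV lam A) z).subtype.dualMap (matC lam A z (Sum.inr p) k) *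
      algebraMap K _ (z k ^ (lam k - 1)) = 0 := by
  -- Product rule: `z^(λ-1) (z dA + λ A dz) = z^λ dA + A d(z^λ)`.
  have h : ∑ k, z k ^ (lam k - 1) • (z k • diffAt (A (Fin.castAdd r p) k) z +
        ((lam k : K) * eval z (A (Fin.castAdd r p) k)) •
          (LinearMap.proj k : (Fin (N + 1) → K) →ₗ[K] K)) = diffAt (fermatV lam A p) z := by
    rw [fermatV, fermat, diffAt_sum]
    refine Finset.sum_congr rfl fun k _ => ?_
    rw [diffAt_mul, diffAt_X_pow, smul_add, smul_smul, smul_smul, smul_smul, ← pow_succ,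
      Nat.sub_add_cancel (hlam k), map_pow, eval_X]
    module
  simp only [matC, Matrix.of_apply, Sum.elim_inr, symMap_ι, mul_comm _ (algebraMap K _ _),
    ← Algebra.smul_def, ← map_smul, ← map_sum]
  rw [h, ← map_zero (SymmetricAlgebra.ι K _)]
  congr 1
  exact LinearMap.ext fun ξ => LinearMap.mem_ker.mp ((Submodule.mem_iInf _).mp ξ.2 p)

/-- Upper and lower rows, restricted to vectors tangent to the cone over `V`, all kill `(z_k ^ (λ_k
- 1))`, so Cramer's rule applies. Its entries at `s` and `t` are exactly the denominators,
invertible here. -/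
theorem cramerForm_glue (hlam : ∀ k, 1 ≤ lam k) (z : cone (zeroLocus (fermat lam A)))
    {s t : Fin (N + 1)} (hs : z.1 s ≠ 0) (ht : z.1 t ≠ 0) :
    symMap (coneTangent (fermatV lam A) z.1).subtype.dualMap (cramerForm lam A hl i j s z.1) =
      symMap (coneTangent (fermatV lam A) z.1).subtype.dualMap
        (cramerForm lam A hl i j t z.1) := by
  set φ := symMap (coneTangent (fermatV lam A) z.1).subtype.dualMap with hφ
  let M : Matrix (Fin N) (Fin (N + 1)) (SymmetricAlgebra K _) :=
    ((matC lam A z.1).submatrix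
      (fun p : Fin N => Fin.append (Sum.inl ∘ i) (Sum.inr ∘ j) (Fin.cast hl.symm p)) id).map φ
  have hM : M.mulVec (fun k => algebraMap K _ (z.1 k ^ (lam k - 1))) = 0 := by
    funext p
    obtain ⟨p, rfl⟩ := (finCongr hl).surjective p
    refine Fin.addCases (fun p => ?_) (fun p => ?_) p
    · have h := congrArg φ (sum_matC_inl hlam z (i p))
      simpa [M, Matrix.mulVec, dotProduct] using h
    · have h := sum_matC_inr (A := A) hlam z.1 (j p)
      simpa [M, Matrix.mulVec, dotProduct] using h
  have h := mul_minor_eq_of_mulVec_eq_zero M _ hM s t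
  have hdet : ∀ s : Fin (N + 1), φ (cramerForm lam A hl i j s z.1) =
      (z.1 s ^ (lam s - 1))⁻¹ • ((-1) ^ (s : ℕ) * (M.submatrix id s.succAbove).det) := by
    intro s
    rw [cramerForm, map_smul, AlgHom.map_det, div_eq_inv_mul, mul_smul]
    congr 1
    rw [Algebra.smul_def, map_pow, map_neg, map_one]
    rfl
  rw [hdet, hdet, inv_smul_eq_iff₀ (pow_ne_zero _ hs), smul_comm,
    eq_inv_smul_iff₀ (pow_ne_zero _ ht), Algebra.smul_def, Algebra.smul_def, h]

/-- The evaluation of the lower rows of `C` at the Euler vector. -/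
theorem lowerRow_self {d : Fin (c + r) → ℕ} (hd : ∀ i j, lam j ≤ d i)
    (hA : ∀ i j, (A i j).IsHomogeneous (d i - lam j)) (z : Fin (N + 1) → K) (p : Fin (c + r))
    (k : Fin (N + 1)) :
    z k * diffAt (A p k) z z + ((lam k : K) * eval z (A p k)) * z k =
      d p * (eval z (A p k) * z k) := by
  rw [diffAt_self (hA p k), Nat.cast_sub (hd p k)]
  ring

/-- The forms `det Ĉ_s` are invariant under changing vectors by multiples of the Euler vector. -/
theorem symMap_cramerForm_of_sub_mem {d : Fin (c + r) → ℕ} (hd : ∀ i j, lam j ≤ d i)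
    (hA : ∀ i j, (A i j).IsHomogeneous (d i - lam j)) (hji : ∀ q, ∃ p, i p = Fin.castAdd r (j q))
    {W : Type*} [AddCommGroup W] [Module K W] (f g : W →ₗ[K] (Fin (N + 1) → K))
    (z : Fin (N + 1) → K) (ε : W →ₗ[K] K) (hfg : ∀ w, f w = g w + ε w • z) (s : Fin (N + 1)) :
    symMap f.dualMap (cramerForm lam A hl i j s z) =
      symMap g.dualMap (cramerForm lam A hl i j s z) := by
  choose τ hτ using hji
  have hdet : ∀ f : W →ₗ[K] (Fin (N + 1) → K), symMap f.dualMap (cramerForm lam A hl i j s z) =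
      ((-1) ^ (s : ℕ) / z s ^ (lam s - 1)) • (Matrix.of fun p : Fin N =>
        Fin.append (fun p k => symMap f.dualMap (matC lam A z (Sum.inl (i p)) (s.succAbove k)))
          (fun q k => symMap f.dualMap (matC lam A z (Sum.inr (j q)) (s.succAbove k)))
          (Fin.cast hl.symm p)).det := by
    intro f
    rw [cramerForm, map_smul, AlgHom.map_det]
    congr 2
    ext p k
    obtain ⟨p, rfl⟩ := (finCongr hl).surjective p
    refine Fin.addCases (fun p => ?_) (fun p => ?_) p <;> simp
  have hU : (fun p k => symMap f.dualMap (matC lam A z (Sum.inl (i p)) (s.succAbove k))) =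
      fun p k => symMap g.dualMap (matC lam A z (Sum.inl (i p)) (s.succAbove k)) := by
    funext p k
    simp [matC]
  -- By Euler's identity the lower row `B` evaluated at `z` is `deg F` times the upper row of the
  -- same index, so the discrepancy `ε z` contributes a multiple of a row already present in the
  -- minor.
  have hB : (fun q k => symMap f.dualMap (matC lam A z (Sum.inr (j q)) (s.succAbove k))) =
      fun q => (fun k => symMap g.dualMap (matC lam A z (Sum.inr (j q)) (s.succAbove k))) +
        (algebraMap K _ (d (Fin.castAdd r (j q)) : K) * SymmetricAlgebra.ι K _ ε) •
          fun k => symMap g.dualMap (matC lam A z (Sum.inl (i (τ q))) (s.succAbove k)) := by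
    funext q k
    simp only [matC, Matrix.of_apply, Sum.elim_inr, symMap_ι, Pi.add_apply, Pi.smul_apply, hτ,
      Sum.elim_inl, AlgHom.commutes, smul_eq_mul]
    rw [mul_right_comm, ← map_mul, ← lowerRow_self hd hA, ← Algebra.smul_def, ← map_smul,
      ← map_add]
    congr 1
    refine LinearMap.ext fun w => ?_
    simp [hfg]
    ring
  rw [hdet, hdet, hU, hB]
  congr 1
  exact det_append_add hl _ (fun q k => symMap g.dualMap (matC lam A z (Sum.inr (j q))
    (s.succAbove k))) τ _

/-- Pull the form back along a linear section of `ξ ↦ [ξ]`; invariance under Euler shifts makes this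
a descent of the form. -/
theorem exists_horForm {d : Fin (c + r) → ℕ} (hd : ∀ i j, lam j ≤ d i)
    (hA : ∀ i j, (A i j).IsHomogeneous (d i - lam j)) (hji : ∀ q, ∃ p, i p = Fin.castAdd r (j q))
    (z : Fin (N + 1) → K) {s : Fin (N + 1)} (hs : z s ≠ 0) :
    ∃ Φ : HorSymFibre (fermatV lam A) l₂ z, symMap (toHor (fermatV lam A) z).dualMap Φ.1 =
      symMap (coneTangent (fermatV lam A) z).subtype.dualMap (cramerForm lam A hl i j s z) := by
  set T := coneTangent (fermatV lam A) z
  obtain ⟨σ, hσ⟩ := (toHor (fermatV lam A) z).exists_rightInverse_of_surjective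
    (LinearMap.range_eq_top.mpr (toHor_surjective _ z))
  refine ⟨⟨_, symMap_mem l₂ σ.dualMap (symMap_cramerForm_mem (lam := lam) (A := A) (hl := hl)
    (i := i) (j := j) s z T)⟩, ?_⟩
  rw [symMap_symMap, symMap_symMap, LinearMap.dualMap_comp_dualMap,
    LinearMap.dualMap_comp_dualMap]
  -- The section returns `ξ + b z` from `[ξ]`; `b` is read off linearly as the `s`-th coordinate of
  -- the difference divided by `z_s`.
  refine symMap_cramerForm_of_sub_mem hd hA hji _ _ z
    ((z s)⁻¹ • LinearMap.proj s ∘ₗ (T.subtype ∘ₗ σ ∘ₗ toHor _ z - T.subtype)) (fun w => ?_) s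
  have h : toHor (fermatV lam A) z (σ (toHor _ z w) - w) = 0 := by
    rw [map_sub, sub_eq_zero]
    exact DFunLike.congr_fun hσ _
  obtain ⟨b, hb⟩ := (toHor_eq_zero_iff _ _ _).mp h
  have hb' : (σ (toHor _ z w)).1 = w.1 + b • z := by
    rw [hb]; simp
  simp [hb', mul_comm b, hs]

/-- The weight is split into a row part and a column part so that both can be pulled out of the
determinant. Integer exponents are needed because `1 - λ_k ≤ 0`. -/
theorem matC_smul_inl {d : Fin (c + r) → ℕ} (hd : ∀ i j, lam j ≤ d i)
    (hA : ∀ i j, (A i j).IsHomogeneous (d i - lam j)) (z : Fin (N + 1) → K) {a : K} (ha : a ≠ 0)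
    (p : Fin (c + r)) (k : Fin (N + 1)) :
    matC lam A (a • z) (Sum.inl p) k =
      (a ^ (d p : ℤ) * a ^ (1 - lam k : ℤ)) • matC lam A z (Sum.inl p) k := by
  have h : a ^ (d p : ℤ) * a ^ (1 - lam k : ℤ) = a ^ (d p - lam k) * a := by
    rw [← zpow_natCast a (d p - lam k), ← zpow_add_one₀ ha, ← zpow_add₀ ha, Nat.cast_sub (hd p k)]
    congr 1
    ring
  rw [h]
  simp only [matC, Matrix.of_apply, Sum.elim_inl]
  rw [eval_smul_of_isHomogeneous (hA p k), Pi.smul_apply, smul_eq_mul, Algebra.smul_def,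
    ← map_mul]
  congr 1
  ring

/-- The coefficients of a lower entry have degree `d_p - λ_k`, one less than the upper entries, and
the forms `dz_k` themselves are not rescaled. -/
theorem matC_smul_inr {d : Fin (c + r) → ℕ} (hd : ∀ i j, lam j ≤ d i)
    (hA : ∀ i j, (A i j).IsHomogeneous (d i - lam j)) (z : Fin (N + 1) → K) {a : K} (ha : a ≠ 0)
    (p : Fin c) (k : Fin (N + 1)) :
    matC lam A (a • z) (Sum.inr p) k =
      (a ^ (d (Fin.castAdd r p) - 1 : ℤ) * a ^ (1 - lam k : ℤ)) • matC lam A z (Sum.inr p) k := by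
  have h : a ^ (d (Fin.castAdd r p) - 1 : ℤ) * a ^ (1 - lam k : ℤ) =
      a ^ (d (Fin.castAdd r p) - lam k) := by
    rw [← zpow_natCast a (d _ - lam k), ← zpow_add₀ ha, Nat.cast_sub (hd _ k)]
    congr 1
    ring
  rw [h]
  simp only [matC, Matrix.of_apply, Sum.elim_inr, ← map_smul]
  rw [Pi.smul_apply, smul_eq_mul, mul_comm a, mul_smul, smul_diffAt_smul (hA _ k),
    eval_smul_of_isHomogeneous (hA _ k)]
  congr 1
  module

theorem cramerForm_smul {d : Fin (c + r) → ℕ} (hd : ∀ i j, lam j ≤ d i)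
    (hlam : ∀ k, 1 ≤ lam k)
    (hA : ∀ i j, (A i j).IsHomogeneous (d i - lam j)) (s : Fin (N + 1))
    (z : Fin (N + 1) → K) {a : K} (ha : a ≠ 0) :
    cramerForm lam A hl i j s (a • z) =
      a ^ (heart lam d i j - l₂) • cramerForm lam A hl i j s z := by
  subst hl
  have hM : (matC lam A (a • z)).submatrix
      (fun p => Fin.append (Sum.inl ∘ i) (Sum.inr ∘ j) (Fin.cast rfl p)) s.succAbove =
      Matrix.of fun p k => (a ^ Fin.append (fun p => (d (i p) : ℤ))
        (fun q => (d (Fin.castAdd r (j q)) - 1 : ℤ)) p * a ^ (1 - lam (s.succAbove k) : ℤ)) •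
        (matC lam A z).submatrix
          (fun p => Fin.append (Sum.inl ∘ i) (Sum.inr ∘ j) (Fin.cast rfl p)) s.succAbove p k := by
    ext p k
    refine Fin.addCases (fun p => ?_) (fun p => ?_) p
    · simpa using matC_smul_inl hd hA z ha (i p) (s.succAbove k)
    · simpa using matC_smul_inr hd hA z ha (j p) (s.succAbove k)
  have hs : (-1) ^ (s : ℕ) / (a • z) s ^ (lam s - 1) =
      a ^ (1 - lam s : ℤ) * ((-1) ^ (s : ℕ) / z s ^ (lam s - 1)) := by
    have h : (1 - lam s : ℤ) = -((lam s - 1 : ℕ) : ℤ) := by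
      rw [Nat.cast_sub (hlam s)]
      simp
    rw [h, zpow_neg, zpow_natCast, Pi.smul_apply, smul_eq_mul, mul_pow, div_eq_mul_inv,
      div_eq_mul_inv, mul_inv]
    ring
  rw [cramerForm, cramerForm, hM, hs, det_smul_smul, prod_zpow_eq_zpow_sum ha,
    prod_zpow_eq_zpow_sum ha, smul_smul, smul_smul, ← zpow_add₀ ha, mul_right_comm,
    ← zpow_add₀ ha]
  congr 3
  -- The omitted column `s` lacks the weight `1 - λ_s`, which the denominator `z_s ^ (λ_s - 1)`
  -- supplies. The column weights thus total `N + 1 - ∑ λ_k` for every `s`, and the lower rows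
  -- account for `-l₂`.
  rw [heart, Fin.sum_univ_add, Fin.sum_univ_succAbove (fun k => (lam k : ℤ)) s]
  simp
  ring

end Fermat

/-! ### Fibrewise bijectivity of the differential of `π` and of evaluation of the twist. -/

section Pullback

variable {K : Type*} [Field K] {N : ℕ} {ι : Type*} {F : ι → MvPolynomial (Fin (N + 1)) K}
  {d : ι → ℕ}

theorem mem_submodule_of_mk_eq {x : ℙ K (Fin (N + 1) → K)} {z : Fin (N + 1) → K} {hz : z ≠ 0}
    (hx : Projectivization.mk K z hz = x) (b : K) : b • z ∈ x.submodule := by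
  subst hx
  rw [Projectivization.submodule_mk]
  exact Submodule.smul_mem _ _ (Submodule.mem_span_singleton_self z)

theorem exists_smul_eq_of_mem_submodule {x : ℙ K (Fin (N + 1) → K)} {z : Fin (N + 1) → K}
    {hz : z ≠ 0} (hx : Projectivization.mk K z hz = x) {w : Fin (N + 1) → K}
    (hw : w ∈ x.submodule) : ∃ b : K, b • z = w := by
  subst hx
  rw [Projectivization.submodule_mk] at hw
  exact Submodule.mem_span_singleton.mp hw

theorem homOfHor_mk_apply (z : Fin (N + 1) → K) (hz : z ≠ 0) (ξ : Fin (N + 1) → K) (b : K)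
    (h : b • z ∈ (Projectivization.mk K z hz).submodule) :
    homOfHor z hz (Submodule.Quotient.mk ξ) ⟨b • z, h⟩ = Submodule.Quotient.mk (b • ξ) := by
  have hz' : b • z ∈ Submodule.span K {z} := by rwa [Projectivization.submodule_mk] at h
  have hb : LinearEquiv.coord K _ z hz ⟨b • z, hz'⟩ = b := by
    apply smul_left_injective K hz
    exact LinearEquiv.coord_apply_smul K _ z hz _
  have h' : homOfHor z hz (Submodule.Quotient.mk ξ) ⟨b • z, h⟩ =
      LinearEquiv.coord K _ z hz ⟨b • z, hz'⟩ • Submodule.Quotient.mk ξ := rfl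
  rw [h', hb]
  rfl

theorem homOfHor_injective (z : Fin (N + 1) → K) (hz : z ≠ 0) :
    Function.Injective (homOfHor z hz) := by
  rw [injective_iff_map_eq_zero]
  intro q hq
  obtain ⟨ξ, rfl⟩ := Submodule.Quotient.mk_surjective _ q
  have h := homOfHor_mk_apply z hz ξ 1 (mem_submodule_of_mk_eq rfl 1)
  rw [hq, LinearMap.zero_apply, eq_comm, Submodule.Quotient.mk_eq_zero,
    Projectivization.submodule_mk, one_smul] at h
  rwa [Submodule.Quotient.mk_eq_zero]

theorem horToTangent_bijective (hF : ∀ i, (F i).IsHomogeneous (d i)) (z : Fin (N + 1) → K)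
    (hz : z ≠ 0) : Function.Bijective (horToTangent hF z hz) := by
  refine ⟨fun q q' h => ?_, fun φ => ?_⟩
  · exact Subtype.ext (homOfHor_injective z hz (congrArg Subtype.val h))
  -- A homomorphism on the line is determined by its value at `z`; writing `z` as `1 • z` matches
  -- the shape of `homOfHor_mk_apply`.
  · obtain ⟨ξ, hξ, h⟩ := φ.2 ⟨(1 : K) • z, mem_submodule_of_mk_eq rfl 1⟩
    refine ⟨toHor F z ⟨ξ, by simpa using hξ⟩, Subtype.ext (LinearMap.ext ?_)⟩
    rintro ⟨w, hw⟩
    obtain ⟨b, rfl⟩ := exists_smul_eq_of_mem_submodule rfl hw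
    refine (homOfHor_mk_apply z hz ξ b hw).trans ?_
    have hb : (⟨b • z, hw⟩ : (Projectivization.mk K z hz).submodule) =
        b • ⟨(1 : K) • z, mem_submodule_of_mk_eq rfl 1⟩ := 
      Subtype.ext (congrArg (b • ·) (one_smul K z).symm)
    rw [hb, map_smul, ← h]
    rfl

theorem evalTwist_bijective (k : ℤ) (z : Fin (N + 1) → K) (hz : z ≠ 0) :
    Function.Bijective (evalTwist k z hz) := by
  have hz' : z ∈ (Projectivization.mk K z hz).submodule := by
    simp
  let w₀ : {w : (Projectivization.mk K z hz).submodule // w ≠ 0} :=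
    ⟨⟨z, hz'⟩, fun h => hz (congrArg Subtype.val h)⟩
  have hw₀ : ∀ w : {w : (Projectivization.mk K z hz).submodule // w ≠ 0},
      ∃ b : K, w.1 = b • w₀.1 := fun w => by
    obtain ⟨b, hb⟩ := exists_smul_eq_of_mem_submodule rfl w.1.2
    exact ⟨b, Subtype.ext hb.symm⟩
  constructor
  · intro f g hfg
    ext w
    obtain ⟨b, hb⟩ := hw₀ w
    rw [f.2 w₀ w b hb, g.2 w₀ w b hb]
    exact congrArg _ hfg
  · intro y
    choose b hb using hw₀
    have hb0 : ∀ w, b w ≠ 0 := fun w h => w.2 (by rw [hb w, h, zero_smul])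
    have hinj : ∀ a a' : K, a • w₀.1 = a' • w₀.1 → a = a' := fun a a' h =>
      smul_left_injective K w₀.2 h
    -- Writing `w = b(w) z`, homogeneity forces this extension of the value `y` at `z`.
    refine ⟨⟨fun w => b w ^ k * y, fun w w' a h => ?_⟩, ?_⟩
    · have : b w' = a * b w := hinj _ _ (by rw [← hb w', mul_smul, ← hb w, h])
      simp only [this, mul_zpow, mul_assoc]
    · change b w₀ ^ k * y = y
      have : b w₀ = 1 := hinj _ _ (by rw [← hb w₀, one_smul])
      simp [this]

end Pullback

/-! ### Linear algebra of pull-backs and twists. -/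

section PullbackMaps

variable {K : Type*} [Field K]

theorem rid_comp_map_bijective {M M' P : Type*} [AddCommMonoid M] [Module K M] [AddCommMonoid M']
    [Module K M'] [AddCommMonoid P] [Module K P] {f : M →ₗ[K] M'} {g : P →ₗ[K] K}
    (hf : Function.Bijective f) (hg : Function.Bijective g) :
    Function.Bijective ((TensorProduct.rid K M').toLinearMap ∘ₗ TensorProduct.map f g) :=
  ((TensorProduct.congr (LinearEquiv.ofBijective f hf) (LinearEquiv.ofBijective g hg)).trans
    (TensorProduct.rid K M')).bijective

theorem symMap_dualMap_symMap_dualMap {T W W' : Type*} [AddCommGroup T] [Module K T]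
    [AddCommGroup W] [Module K W] [AddCommGroup W'] [Module K W'] (u : T →ₗ[K] W)
    (f : W →ₗ[K] W') {g : T →ₗ[K] W'} (h : f ∘ₗ u = g) (b : K)
    (σ : SymmetricAlgebra K (Module.Dual K W')) :
    symMap u.dualMap (b • symMap f.dualMap σ) = b • symMap g.dualMap σ := by
  rw [← h, map_smul, symMap_symMap, LinearMap.dualMap_comp_dualMap]

theorem symMap_dualMap_smul_comp {T T' W : Type*} [AddCommGroup T] [Module K T]
    [AddCommGroup T'] [Module K T'] [AddCommGroup W] [Module K W] {u : T →ₗ[K] T'}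
    {f : T' →ₗ[K] W} {g : T →ₗ[K] W} {a : K} (h : f ∘ₗ u = a • g) {b b' e : K} {l : ℕ}
    (hb : b * a ^ l = e * b') {σ : SymmetricAlgebra K (Module.Dual K W)}
    (hσ : σ ∈ SymPow K l (Module.Dual K W)) :
    symMap u.dualMap (b • symMap f.dualMap σ) = e • b' • symMap g.dualMap σ := by
  have hdual : (a • g).dualMap = a • g.dualMap := by
    ext
    simp
  rw [symMap_dualMap_symMap_dualMap u f h, hdual, symMap_smul _ _ hσ, smul_smul, hb, mul_smul]

/-- Reduces a scaling identity to pure tensors. Additivity is a hypothesis on plain functions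
because `pullbackCone`, defined through a transport, is not bundled as a linear map. -/
theorem tensor_induction_smul {M P S S' : Type*} [AddCommMonoid M] [Module K M]
    [AddCommMonoid P] [Module K P] [AddCommGroup S] [Module K S] [AddCommGroup S'] [Module K S']
    {f : M ⊗[K] P → S} {g : M ⊗[K] P → S'} (u : S →ₗ[K] S') (b : K) (hf0 : f 0 = 0) (hg0 : g 0 = 0)
    (hf : ∀ t t', f (t + t') = f t + f t') (hg : ∀ t t', g (t + t') = g t + g t')
    (h : ∀ σ p, u (f (σ ⊗ₜ p)) = b • g (σ ⊗ₜ p)) (t : M ⊗[K] P) : u (f t) = b • g t := by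
  induction t using TensorProduct.induction_on with
  | zero => rw [hf0, hg0, map_zero, smul_zero]
  | tmul σ p => exact h σ p
  | add t t' h h' => rw [hf, hg, map_add, smul_add, h, h']

end PullbackMaps

/-! ### Scaling of pull-backs along a line, and descent from the cone. -/

section Pullback

variable {K : Type*} [Field K] {N : ℕ} {ι : Type*} {F : ι → MvPolynomial (Fin (N + 1)) K}
  {d : ι → ℕ}

theorem pullbackAt_bijective (hF : ∀ i, (F i).IsHomogeneous (d i)) (l : ℕ) (k : ℤ)
    (z : Fin (N + 1) → K) (hz : z ≠ 0) : Function.Bijective (pullbackAt hF l k z hz) := by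
  have h := symPowMap_dualMap_bijective (W := horTangent F z)
    (W' := tangentSpace F (Projectivization.mk K z hz)) (f := horToTangent hF z hz)
    (horToTangent_bijective hF z hz) l
  exact rid_comp_map_bijective h (evalTwist_bijective k z hz)

theorem pullback_injective (hF : ∀ i, (F i).IsHomogeneous (d i)) {l : ℕ} {k : ℤ}
    {Y : Set (ℙ K (Fin (N + 1) → K))} :
    Function.Injective (pullback hF (l := l) (k := k) (Y := Y)) := by
  intro ω ω' h
  funext ⟨x, hx⟩
  induction x using Projectivization.ind with
  | h z hz => exact (pullbackAt_bijective hF l k z hz).1 (congrFun h ⟨z, hz, hx⟩)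

/-- The differential of `π`, on the tangent space at `z` of the cone over `V`, for a vector `z` on
the line `x`. -/
noncomputable def coneToTangent (hF : ∀ i, (F i).IsHomogeneous (d i))
    {x : ℙ K (Fin (N + 1) → K)} (z : Fin (N + 1) → K) {hz : z ≠ 0}
    (hx : Projectivization.mk K z hz = x) : coneTangent F z →ₗ[K] tangentSpace F x :=
  hx ▸ (horToTangent hF z hz ∘ₗ toHor F z)

theorem coneToTangent_apply (hF : ∀ i, (F i).IsHomogeneous (d i))
    {x : ℙ K (Fin (N + 1) → K)} {z : Fin (N + 1) → K} {hz : z ≠ 0}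
    (hx : Projectivization.mk K z hz = x) (ξ : coneTangent F z) (b : K)
    (h : b • z ∈ x.submodule) :
    (coneToTangent hF z hx ξ).1 ⟨b • z, h⟩ = Submodule.Quotient.mk (b • ξ.1) := by
  subst hx
  exact homOfHor_mk_apply z hz ξ.1 b h

/-- The homomorphism sending `a z` to `[ξ]` sends `z` to `[a⁻¹ ξ]`. -/
theorem coneToTangent_smul (hF : ∀ i, (F i).IsHomogeneous (d i))
    {x : ℙ K (Fin (N + 1) → K)} {z : Fin (N + 1) → K} {hz : z ≠ 0}
    (hx : Projectivization.mk K z hz = x) {a : K} (ha : a ≠ 0) {hz' : a • z ≠ 0}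
    (hx' : Projectivization.mk K (a • z) hz' = x) :
    coneToTangent hF (a • z) hx' ∘ₗ Submodule.inclusion (coneTangent_le_smul hF a z) =
      a⁻¹ • coneToTangent hF z hx := by
  refine LinearMap.ext fun ξ => Subtype.ext (LinearMap.ext fun w => ?_)
  obtain ⟨w, hw⟩ := w
  obtain ⟨b, rfl⟩ := exists_smul_eq_of_mem_submodule hx hw
  have h1 := coneToTangent_apply hF hx ξ b hw
  have h2 := coneToTangent_apply hF hx' (Submodule.inclusion (coneTangent_le_smul hF a z) ξ)
    (b * a⁻¹) (mem_submodule_of_mk_eq hx' _)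
  simp only [smul_smul, mul_assoc, inv_mul_cancel₀ ha, mul_one] at h2
  change (coneToTangent hF (a • z) hx' (Submodule.inclusion _ ξ)).1 ⟨b • z, hw⟩ =
    a⁻¹ • (coneToTangent hF z hx ξ).1 ⟨b • z, hw⟩
  rw [h1, h2, ← Submodule.Quotient.mk_smul, smul_smul, mul_comm]
  rfl

/-- Pull-back of elements of the fibre of `Sym^l Ω_V (k)` at the line `x` to the tangent space at a
vector `z` on this line of the cone over `V`. -/
noncomputable def pullbackCone (hF : ∀ i, (F i).IsHomogeneous (d i)) (l : ℕ) (k : ℤ)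
    {x : ℙ K (Fin (N + 1) → K)} (z : Fin (N + 1) → K) {hz : z ≠ 0}
    (hx : Projectivization.mk K z hz = x) (t : TwistedSymFibre F l k x) :
    SymmetricAlgebra K (Module.Dual K (coneTangent F z)) :=
  symMap (toHor F z).dualMap (pullbackAt hF l k z hz (hx.symm ▸ t)).1

theorem pullbackCone_rfl (hF : ∀ i, (F i).IsHomogeneous (d i)) {l : ℕ} {k : ℤ}
    {z : Fin (N + 1) → K} {hz : z ≠ 0} (t : TwistedSymFibre F l k (Projectivization.mk K z hz)) :
    pullbackCone hF l k z rfl t = symMap (toHor F z).dualMap (pullbackAt hF l k z hz t).1 :=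
  rfl

/-- The lines through `z` and `a z` are equal, but not definitionally. `pullbackCone` evaluates one
element of one fibre at any representative of the line, and this lemma links it back to `pullback`.
-/
theorem pullbackCone_apply (hF : ∀ i, (F i).IsHomogeneous (d i)) {l : ℕ} {k : ℤ}
    {Y : Set (ℙ K (Fin (N + 1) → K))} (ω : ∀ x : Y, TwistedSymFibre F l k x.1) (z : cone Y) {x : _}
    (hxY : x ∈ Y)
    (hx : Projectivization.mk K z.1 (cone_ne_zero z) = x) :
    pullbackCone hF l k z.1 hx (ω ⟨x, hxY⟩) = symMap (toHor F z.1).dualMap (pullback hF ω z).1 := by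
  subst hx
  rfl

theorem pullbackCone_zero (hF : ∀ i, (F i).IsHomogeneous (d i)) {l : ℕ} {k : ℤ}
    {x : ℙ K (Fin (N + 1) → K)} {z : Fin (N + 1) → K} {hz : z ≠ 0}
    (hx : Projectivization.mk K z hz = x) :
    pullbackCone hF l k z hx 0 = 0 := by
  subst hx
  rw [pullbackCone_rfl, map_zero, Submodule.coe_zero, map_zero]

theorem pullbackCone_add (hF : ∀ i, (F i).IsHomogeneous (d i)) {l : ℕ} {k : ℤ}
    {x : ℙ K (Fin (N + 1) → K)} {z : Fin (N + 1) → K} {hz : z ≠ 0}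
    (hx : Projectivization.mk K z hz = x) (t t' : TwistedSymFibre F l k x) :
    pullbackCone hF l k z hx (t + t') = pullbackCone hF l k z hx t + pullbackCone hF l k z hx t' := by
  subst hx
  rw [pullbackCone_rfl, map_add, Submodule.coe_add, map_add]
  rfl

theorem pullbackAt_tmul (hF : ∀ i, (F i).IsHomogeneous (d i)) {l : ℕ} {k : ℤ}
    {z : Fin (N + 1) → K} {hz : z ≠ 0}
    (σ : SymPow K l (Module.Dual K (tangentSpace F (Projectivization.mk K z hz))))
    (f : twistFibre k (Projectivization.mk K z hz)) :
    (pullbackAt hF l k z hz (σ ⊗ₜ[K] f)).1 =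
      evalTwist k z hz f • symMap (horToTangent hF z hz).dualMap σ.1 :=
  rfl

theorem pullbackCone_tmul (hF : ∀ i, (F i).IsHomogeneous (d i)) {l : ℕ} {k : ℤ}
    {x : ℙ K (Fin (N + 1) → K)} {z : Fin (N + 1) → K} {hz : z ≠ 0}
    (hx : Projectivization.mk K z hz = x)
    (σ : SymPow K l (Module.Dual K (tangentSpace F x))) (f : twistFibre k x)
    (w : {w : x.submodule // w ≠ 0}) (hw : w.1.1 = z) :
    pullbackCone hF l k z hx (σ ⊗ₜ[K] f) =
      f.1 w • symMap (coneToTangent hF z hx).dualMap σ.1 := by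
  subst hx
  obtain ⟨⟨w, hw'⟩, hw''⟩ := w
  obtain rfl : w = z := hw
  have h := symMap_dualMap_symMap_dualMap (T := coneTangent F w) (W := horTangent F w)
    (W' := tangentSpace F (Projectivization.mk K w hz)) (toHor F w) (horToTangent hF w hz)
    (g := coneToTangent hF w rfl) rfl (evalTwist k w hz f) σ.1
  exact (congrArg (symMap (toHor F w).dualMap) (pullbackAt_tmul hF σ f)).trans h

/-- The twist contributes `a ^ k` and the `l` cotangent factors contribute `a⁻¹` each. -/
theorem pullbackCone_smul_tmul (hF : ∀ i, (F i).IsHomogeneous (d i)) {l : ℕ} {k : ℤ}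
    {x : ℙ K (Fin (N + 1) → K)} {z : Fin (N + 1) → K} {hz : z ≠ 0}
    (hx : Projectivization.mk K z hz = x) {a : K} (ha : a ≠ 0) {hz' : a • z ≠ 0}
    (hx' : Projectivization.mk K (a • z) hz' = x)
    (σ : SymPow K l (Module.Dual K (tangentSpace F x))) (f : twistFibre k x) :
    symMap (Submodule.inclusion (coneTangent_le_smul hF a z)).dualMap
        (pullbackCone hF l k (a • z) hx' (σ ⊗ₜ[K] f)) =
      a ^ (k - l) • pullbackCone hF l k z hx (σ ⊗ₜ[K] f) := by
  let w : {w : x.submodule // w ≠ 0} :=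
    ⟨⟨(1 : K) • z, mem_submodule_of_mk_eq hx 1⟩,
      fun h => hz ((one_smul K z).symm.trans (congrArg Subtype.val h))⟩
  let w' : {w : x.submodule // w ≠ 0} :=
    ⟨⟨a • z, mem_submodule_of_mk_eq hx a⟩, fun h => hz' (congrArg Subtype.val h)⟩
  have hw : f.1 w' = a ^ k * f.1 w :=
    f.2 w w' a (Subtype.ext (congrArg (a • ·) (one_smul K z).symm))
  have hb : f.1 w' * a⁻¹ ^ l = a ^ (k - l) * f.1 w := by
    rw [hw, zpow_sub₀ ha, zpow_natCast, inv_pow, div_eq_mul_inv]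
    ring
  have h₁ := pullbackCone_tmul hF hx' σ f w' rfl
  have h₂ := pullbackCone_tmul hF hx σ f w (one_smul _ _)
  have h := symMap_dualMap_smul_comp (T := coneTangent F z) (T' := coneTangent F (a • z))
    (W := tangentSpace F x) (coneToTangent_smul hF hx ha hx') hb σ.2
  exact (congrArg (symMap _) h₁).trans (h.trans (congrArg (a ^ (k - l) • ·) h₂.symm))

theorem pullbackCone_smul (hF : ∀ i, (F i).IsHomogeneous (d i)) {l : ℕ} {k : ℤ}
    {x : ℙ K (Fin (N + 1) → K)} {z : Fin (N + 1) → K} {hz : z ≠ 0}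
    (hx : Projectivization.mk K z hz = x) {a : K} (ha : a ≠ 0) {hz' : a • z ≠ 0}
    (hx' : Projectivization.mk K (a • z) hz' = x) (t : TwistedSymFibre F l k x) :
    symMap (Submodule.inclusion (coneTangent_le_smul hF a z)).dualMap
        (pullbackCone hF l k (a • z) hx' t) = a ^ (k - l) • pullbackCone hF l k z hx t :=
  tensor_induction_smul
    (symMap (Submodule.inclusion (coneTangent_le_smul hF a z)).dualMap).toLinearMap _
    (pullbackCone_zero hF hx') (pullbackCone_zero hF hx) (pullbackCone_add hF hx')
    (pullbackCone_add hF hx) (pullbackCone_smul_tmul hF hx ha hx') t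

theorem inclusion_coneTangent_surjective (hF : ∀ i, (F i).IsHomogeneous (d i))
    (z : Fin (N + 1) → K) {a : K} (ha : a ≠ 0) :
    Function.Surjective (Submodule.inclusion (coneTangent_le_smul hF a z)) := by
  rintro ⟨ξ, hξ⟩
  have h := coneTangent_le_smul hF a⁻¹ (a • z) hξ
  rw [inv_smul_smul₀ ha] at h
  exact ⟨⟨ξ, h⟩, rfl⟩

theorem pullback_smul (hF : ∀ i, (F i).IsHomogeneous (d i)) {l : ℕ} {k : ℤ}
    {Y : Set (ℙ K (Fin (N + 1) → K))} (ω : ∀ x : Y, TwistedSymFibre F l k x.1) (z : cone Y) {a : K}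
    (ha : a ≠ 0) (haz : a • z.1 ∈ cone Y) :
    symMap (Submodule.inclusion (coneTangent_le_smul hF a z.1)).dualMap
        (symMap (toHor F (a • z.1)).dualMap (pullback hF ω ⟨a • z.1, haz⟩).1) =
      a ^ (k - l) • symMap (toHor F z.1).dualMap (pullback hF ω z).1 := by
  have hx : Projectivization.mk K (a • z.1) (cone_ne_zero ⟨_, haz⟩) =
      Projectivization.mk K z.1 (cone_ne_zero z) :=
    (Projectivization.mk_eq_mk_iff' K _ _ _ _).mpr ⟨a, rfl⟩
  have h₁ := pullbackCone_apply hF ω ⟨a • z.1, haz⟩ (cone_mk_mem z) hx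
  have h₂ := pullbackCone_apply hF ω z (cone_mk_mem z) rfl
  have h := pullbackCone_smul hF rfl ha hx (ω ⟨_, cone_mk_mem z⟩)
  exact (congrArg (symMap _) h₁.symm).trans (h.trans (congrArg (a ^ (k - l) • ·) h₂))

theorem exists_pullback_apply_eq (hF : ∀ i, (F i).IsHomogeneous (d i)) (l : ℕ) (k : ℤ)
    {Y : Set (ℙ K (Fin (N + 1) → K))} (Φ : ∀ z : cone Y, HorSymFibre F l z.1) :
    ∃ ω : ∀ x : Y, TwistedSymFibre F l k x.1, ∀ x : Y, ∃ z : cone Y,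
      Projectivization.mk K z.1 (cone_ne_zero z) = x.1 ∧ pullback hF ω z = Φ z := by
  -- `pullback` takes a whole family as argument, so the pointwise choice is stated for every family
  -- with value `t` at `x`; the chosen values then assemble into one family.
  have h : ∀ x : Y, ∃ (t : TwistedSymFibre F l k x.1), ∀ ω : ∀ x : Y, TwistedSymFibre F l k x.1,
      ω x = t → ∃ z : cone Y,
        Projectivization.mk K z.1 (cone_ne_zero z) = x.1 ∧ pullback hF ω z = Φ z := by
    rintro ⟨x, hx⟩
    induction x using Projectivization.ind with
    | h z hz =>
      obtain ⟨t, ht⟩ := (pullbackAt_bijective hF l k z hz).2 (Φ ⟨z, hz, hx⟩)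
      exact ⟨t, fun ω hω => ⟨⟨z, hz, hx⟩, rfl, (congrArg (pullbackAt hF l k z hz) hω).trans ht⟩⟩
  choose ω hω using h
  exact ⟨ω, fun x => hω x ω rfl⟩

/-- A family of horizontal forms on a cone which is homogeneous of the right degree is a
pull-back. -/
theorem exists_pullback_eq (hF : ∀ i, (F i).IsHomogeneous (d i)) {l : ℕ} {k : ℤ}
    {Y : Set (ℙ K (Fin (N + 1) → K))} (Φ : ∀ z : cone Y, HorSymFibre F l z.1)
    (hΦ : ∀ (z : cone Y) (a : K), a ≠ 0 → ∀ haz : a • z.1 ∈ cone Y,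
      symMap (Submodule.inclusion (coneTangent_le_smul hF a z.1)).dualMap
        (symMap (toHor F (a • z.1)).dualMap (Φ ⟨a • z.1, haz⟩).1) =
      a ^ (k - l) • symMap (toHor F z.1).dualMap (Φ z).1) :
    ∃ ω : ∀ x : Y, TwistedSymFibre F l k x.1, pullback hF ω = Φ := by
  obtain ⟨ω, hω⟩ := exists_pullback_apply_eq hF l k Φ
  refine ⟨ω, funext fun z' => ?_⟩
  obtain ⟨z, hz, hωz⟩ := hω ⟨_, cone_mk_mem z'⟩
  obtain ⟨a, ha⟩ := (Projectivization.mk_eq_mk_iff' K _ _ (cone_ne_zero z')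
    (cone_ne_zero z)).mp hz.symm
  have ha₀ : a ≠ 0 := by
    rintro rfl
    exact cone_ne_zero z' (ha.symm.trans (zero_smul K z.1))
  obtain ⟨z', hz'⟩ := z'
  obtain rfl : a • z.1 = z' := ha
  have h₀ := congrArg (fun s => a ^ (k - l) • symMap (toHor F z.1).dualMap s.1) hωz
  have h₁ := (hΦ z a ha₀ hz').trans h₀.symm
  -- The family `ω` matches `Φ` at one chosen vector `z` of the line, and both scale alike, so they
  -- agree at `a z` after restriction to vectors tangent at `z`. Two surjections are then cancelled:
  -- the inclusion of tangent spaces and the quotient by the Euler direction.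
  have h := symMap_dualMap_injective (W := coneTangent F z.1) (W' := coneTangent F (a • z.1))
    (inclusion_coneTangent_surjective hF z.1 ha₀) ((pullback_smul hF ω z ha₀ hz').trans h₁.symm)
  exact Subtype.ext (symMap_dualMap_injective (W := coneTangent F (a • z.1))
    (W' := horTangent F (a • z.1)) (toHor_surjective F _) h)

end Pullback

/-! ### Regularity of twisted sections and multiplication by polynomials. -/

section TwistedSections

variable {K : Type*} [Field K] {N : ℕ} {ι : Type*} {F : ι → MvPolynomial (Fin (N + 1)) K}
  {d : ι → ℕ}

theorem rid_map_lTensor {M M' P P' : Type*} [AddCommMonoid M] [Module K M] [AddCommMonoid M']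
    [Module K M'] [AddCommMonoid P] [Module K P] [AddCommMonoid P'] [Module K P'] (f : M →ₗ[K] M')
    {g : P →ₗ[K] K} {g' : P' →ₗ[K] K} {m : P →ₗ[K] P'} {b : K} (h : ∀ p, g' (m p) = b * g p)
    (t : M ⊗[K] P) :
    ((TensorProduct.rid K M').toLinearMap ∘ₗ TensorProduct.map f g') (m.lTensor M t) =
      b • ((TensorProduct.rid K M').toLinearMap ∘ₗ TensorProduct.map f g) t := by
  induction t using TensorProduct.induction_on with
  | zero => simp
  | tmul σ p => simp [h, mul_smul]
  | add t t' h h' => rw [map_add, map_add, map_add, smul_add, h, h']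

theorem pullback_mulSection (hF : ∀ i, (F i).IsHomogeneous (d i))
    {P : MvPolynomial (Fin (N + 1)) K} {e : ℕ} (hP : P.IsHomogeneous e) {l : ℕ} {k : ℤ}
    {Y : Set (ℙ K (Fin (N + 1) → K))} (ω : ∀ x : Y, TwistedSymFibre F l k x.1) (z : cone Y) :
    pullback hF (mulSection hP ω) z = eval z.1 P • pullback hF ω z :=
  rid_map_lTensor (symPowMap l (horToTangent hF z.1 (cone_ne_zero z)).dualMap)
    (g := evalTwist k z.1 (cone_ne_zero z)) (g' := evalTwist (e + k) z.1 (cone_ne_zero z))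
    (m := mulTwist hP k _) (b := eval z.1 P) (fun _ => rfl) (ω ⟨_, cone_mk_mem z⟩)

/-- A local expression on the cone restricts to each slice `z_j = 1`, so the same `h` and `Q` serve
in the affine chart. -/
theorem mem_twistedSections_of_pullback_mem (hF : ∀ i, (F i).IsHomogeneous (d i)) {l : ℕ} {k : ℤ}
    {Y : Set (ℙ K (Fin (N + 1) → K))} {ω : ∀ x : Y, TwistedSymFibre F l k x.1}
    (hω : pullback hF ω ∈ horSections F l Y) : ω ∈ twistedSections hF l k Y := by
  intro j z₀ _
  obtain ⟨h, Q, hQ, h₀, hh⟩ := hω z₀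
  refine ⟨h, Q, hQ, h₀, fun z _ hz => ?_⟩
  rw [affineToHor_eq, hh z hz, map_smul, symMap_inclusion_formAt]

theorem mulSection_mem_twistedSections (hF : ∀ i, (F i).IsHomogeneous (d i))
    {P : MvPolynomial (Fin (N + 1)) K} {e : ℕ} (hP : P.IsHomogeneous e) {l : ℕ} {k : ℤ}
    {Y : Set (ℙ K (Fin (N + 1) → K))} {ω : ∀ x : Y, TwistedSymFibre F l k x.1}
    (hω : ω ∈ twistedSections hF l k Y) :
    mulSection hP ω ∈ twistedSections hF l ((e : ℤ) + k) Y := by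
  intro j z₀ hj₀
  obtain ⟨h, Q, hQ, h₀, hh⟩ := hω j z₀ hj₀
  refine ⟨h, C P * Q, ?_, h₀, fun z hj hz => ?_⟩
  · simpa only [zero_add] using (isHomogeneous_C _ P).mul hQ
  · rw [pullback_mulSection, formAt_C_mul, smul_comm, ← hh z hj hz, ← map_smul]
    rfl

end TwistedSections

/-! ### The glued form: uniqueness, existence, regularity and weight. -/

section Fermat

variable {K : Type*} [Field K] {N c r l₁ l₂ : ℕ} {lam : Fin (N + 1) → ℕ}
  {A : Fin (c + r) → Fin (N + 1) → MvPolynomial (Fin (N + 1)) K} {hl : l₁ + l₂ = N}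
  {i : Fin l₁ → Fin (c + r)} {j : Fin l₂ → Fin c}

theorem IsGlued.unique {Φ Ψ : ∀ z : cone (zeroLocus (fermat lam A)), HorSymFibre (fermatV lam A)
    l₂ z.1} (hΦ : IsGlued lam A hl i j Φ) (hΨ : IsGlued lam A hl i j Ψ) : Φ = Ψ := by
  funext z
  obtain ⟨s, hs⟩ := exists_ne_zero_of_mem_cone z
  exact Subtype.ext (symMap_dualMap_injective (W := coneTangent (fermatV lam A) z.1)
    (W' := horTangent (fermatV lam A) z.1) (toHor_surjective _ _)
    ((hΦ s z hs).trans (hΨ s z hs).symm))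

theorem exists_isGlued (hlam : ∀ k, 1 ≤ lam k) {d : Fin (c + r) → ℕ} (hd : ∀ i j, lam j ≤ d i)
    (hA : ∀ i j, (A i j).IsHomogeneous (d i - lam j))
    (hji : ∀ q, ∃ p, i p = Fin.castAdd r (j q)) : ∃ Φ, IsGlued lam A hl i j Φ := by
  choose σ hσ using fun z : cone (zeroLocus (fermat lam A)) => exists_ne_zero_of_mem_cone z
  choose Φ hΦ using fun z : cone (zeroLocus (fermat lam A)) =>
    exists_horForm (hl := hl) hd hA hji z.1 (hσ z)
  exact ⟨Φ, fun s z hs => (hΦ z).trans (cramerForm_glue hlam z (hσ z) hs)⟩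

theorem IsGlued.mem_horSections (hlam : ∀ k, 1 ≤ lam k) {Φ : ∀ z : cone (zeroLocus (fermat lam A)),
    HorSymFibre (fermatV lam A) l₂ z.1} (hΦ : IsGlued lam A hl i j Φ) :
    Φ ∈ horSections (fermatV lam A) l₂ (zeroLocus (fermat lam A)) := by
  intro z₀
  obtain ⟨s, hs⟩ := exists_ne_zero_of_mem_cone z₀
  -- The denominator is `z_s ^ λ_s`, compensated by an extra `z_s` in the numerator. If `λ_s = 1`,
  -- then `z_s ^ (λ_s - 1)` would be `1`, and its nonvanishing would not give the needed `z_s ≠ 0`.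
  refine ⟨X s ^ lam s, C ((-1) ^ (s : ℕ) * X s) * polyCramer lam A hl i j s, ?_, ?_,
    fun z hz => ?_⟩
  · simpa only [zero_add] using (isHomogeneous_C _ _).mul (polyCramer_isHomogeneous s)
  · simpa using pow_ne_zero _ hs
  · simp only [map_pow, eval_X] at hz ⊢
    have hzs : z.1 s ≠ 0 := fun h => hz (by rw [h, zero_pow (Nat.one_le_iff_ne_zero.mp (hlam s))])
    rw [hΦ s z hzs, formAt_polyCramer, formAt_C_mul, smul_smul]
    congr 1
    simp only [map_mul, map_pow, map_neg, map_one, eval_X]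
    rw [← Nat.sub_add_cancel (hlam s), Nat.add_sub_cancel, pow_succ]
    field_simp

theorem IsGlued.smul (hlam : ∀ k, 1 ≤ lam k) {d : Fin (c + r) → ℕ} (hd : ∀ i j, lam j ≤ d i)
    (hA : ∀ i j, (A i j).IsHomogeneous (d i - lam j)) {Φ : ∀ z : cone (zeroLocus (fermat lam A)),
    HorSymFibre (fermatV lam A) l₂ z.1} (hΦ : IsGlued lam A hl i j Φ)
    (z : cone (zeroLocus (fermat lam A))) {a : K} (ha : a ≠ 0)
    (haz : a • z.1 ∈ cone (zeroLocus (fermat lam A))) :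
    symMap (Submodule.inclusion
        (coneTangent_le_smul (fermatV_isHomogeneous hd hA) a z.1)).dualMap
        (symMap (toHor (fermatV lam A) (a • z.1)).dualMap (Φ ⟨a • z.1, haz⟩).1) =
      a ^ (heart lam d i j - l₂) • symMap (toHor (fermatV lam A) z.1).dualMap (Φ z).1 := by
  obtain ⟨s, hs⟩ := exists_ne_zero_of_mem_cone z
  have h₁ := hΦ s ⟨a • z.1, haz⟩ (mul_ne_zero ha hs)
  have h₂ := hΦ s z hs
  have h₃ := symMap_inclusion_subtype (coneTangent_le_smul (fermatV_isHomogeneous hd hA) a z.1)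
    (cramerForm lam A hl i j s (a • z.1))
  have h₄ := congrArg (symMap (coneTangent (fermatV lam A) z.1).subtype.dualMap)
    (cramerForm_smul (hl := hl) (i := i) (j := j) hd hlam hA s z.1 ha)
  rw [map_smul, ← h₂] at h₄
  exact (congrArg (symMap _) h₁).trans (h₃.trans h₄)

end Fermat

end SymForm

theorem mainTheorem7 {K : Type*} [Field K] [IsAlgClosed K] (N c r : ℕ) (hN : 2 ≤ N)
    (hcN : N ≤ 2 * c + r) (hcr : c + r ≤ N - 1)
    (lam : Fin (N + 1) → ℕ) (hlam : ∀ j, 1 ≤ lam j)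
    (d : Fin (c + r) → ℕ) (hd : ∀ i j, lam j ≤ d i)
    (A : Fin (c + r) → Fin (N + 1) → MvPolynomial (Fin (N + 1)) K)
    (hA : ∀ i j, (A i j).IsHomogeneous (d i - lam j))
    (hV : SymForm.IsSmoothCompleteIntersection (SymForm.fermatV lam A))
    (hX : SymForm.IsSmoothCompleteIntersection (SymForm.fermat lam A))
    (l₁ l₂ : ℕ) (hl₂ : 1 ≤ l₂) (hl₁ : l₂ ≤ l₁) (hl : l₁ + l₂ = N)
    (i : Fin l₁ → Fin (c + r)) (hi : StrictMono i)
    (j : Fin l₂ → Fin c) (hj : StrictMono j) (hji : ∀ q, ∃ p, i p = Fin.castAdd r (j q)) :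
    (∃! Φ, Φ ∈ SymForm.horSections (SymForm.fermatV lam A) l₂
        (SymForm.zeroLocus (SymForm.fermat lam A)) ∧ SymForm.IsGlued lam A hl i j Φ) ∧
    ∀ Φ ∈ SymForm.horSections (SymForm.fermatV lam A) l₂
        (SymForm.zeroLocus (SymForm.fermat lam A)), SymForm.IsGlued lam A hl i j Φ →
      (∃! ω, ω ∈ SymForm.twistedSections (SymForm.fermatV_isHomogeneous hd hA) l₂
          (SymForm.heart lam d i j) (SymForm.zeroLocus (SymForm.fermat lam A)) ∧
        SymForm.pullback (SymForm.fermatV_isHomogeneous hd hA) ω = Φ) ∧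
      ∀ ω ∈ SymForm.twistedSections (SymForm.fermatV_isHomogeneous hd hA) l₂
          (SymForm.heart lam d i j) (SymForm.zeroLocus (SymForm.fermat lam A)),
        SymForm.pullback (SymForm.fermatV_isHomogeneous hd hA) ω = Φ →
        ∀ (e : ℕ) (P : MvPolynomial (Fin (N + 1)) K) (hP : P.IsHomogeneous e),
          SymForm.mulSection hP ω ∈
            SymForm.twistedSections (SymForm.fermatV_isHomogeneous hd hA) l₂
              ((e : ℤ) + SymForm.heart lam d i j)
              (SymForm.zeroLocus (SymForm.fermat lam A)) := by
  have hF := SymForm.fermatV_isHomogeneous hd hA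
  refine ⟨?_, fun Φ hΦ hglue => ⟨?_, fun ω hω _ e P hP =>
    SymForm.mulSection_mem_twistedSections hF hP hω⟩⟩
  · obtain ⟨Φ, hΦ⟩ := SymForm.exists_isGlued (hl := hl) hlam hd hA hji
    exact ⟨Φ, ⟨hΦ.mem_horSections hlam, hΦ⟩, fun Ψ hΨ => hΨ.2.unique hΦ⟩
  · obtain ⟨ω, hω⟩ := SymForm.exists_pullback_eq hF (k := SymForm.heart lam d i j) Φ
      fun z a ha haz => hglue.smul hlam hd hA z ha haz
    refine ⟨ω, ⟨SymForm.mem_twistedSections_of_pullback_mem hF (hω.symm ▸ hΦ), hω⟩,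
      fun ω' hω' => SymForm.pullback_injective hF (hω'.2.trans hω.symm)⟩
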